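/- **Setting.** A cycle of length $L$ is represented by the line from $0$ to $L$, with the points $0$ and $L$ identified. On it move $n$ robots, indexed cyclically ($n+1=1$, $0=n$) and sorted from left to right; robot $i$ has a communication radius $r_i\ge 0$ and a maximum speed $v_i>0$, and $L>2\sum_i r_i$ (the cycle cannot be covered by robots at static positions). Robot $i$ has a position $p_i(t)$, an orientation $o_i(t)\in\{-1,+1\}$ and an activity $a_i(t)\in\{0,1\}$ (stopped or moving), and between events $\dot p_i=v_i a_i o_i$ while all other variables are constant. Between robots $i$ and $i+1$ there is a boundary $y_i(t)$, which may be unknown; $y_n(t)=L$ is fixed and known, and $y_0:=0$ is the same point of the cycle. The region of robot $i$ is $[y_{i-1},y_i]$, and its traversing time is $e_i=(y_i-y_{i-1}-2r_i)/v_i$. Robot $i$ *is at its right boundary* if $o_i=+1$ and $p_i+r_i=y_i$, and *at its left boundary* if $o_i=-1$ and $p_i-r_i=y_{i-1}$. **Method.** The following events take place as soon as they are possible (simultaneous ones in any order). * *Discovery* ($y_i$ unknown, $a_i=a_{i+1}=1$, $o_i=+1$, $o_{i+1}=-1$, $p_i+r_i=p_{i+1}-r_{i+1}$): set $y_i:=p_i+r_i$,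 $o_i:=-1$, $o_{i+1}:=+1$. * *Catch* ($y_i$ unknown, $a_i=1$, $o_i=o_{i+1}=+1$, robot $i+1$ stopped or $v_{i+1}<v_i$, $p_i+r_i=p_{i+1}-r_{i+1}$): set $y_i:=p_i+r_i$, $a_i:=0$, $a_{i+1}:=1$; and symmetrically when robot $i+1$, moving backward, catches robot $i$. * *Arrival*: a moving robot that is at its right (left) boundary, while the neighbour is not at this boundary, stops. * *Meeting* (robot $i$ is at its right and robot $i+1$ at its left boundary): if $i\neq n$ and $y_{i-1},y_{i+1}$ are known, set $$y_i:=\frac{v_{i+1}(y_{i-1}+2r_i)+v_i(y_{i+1}-2r_{i+1})}{v_i+v_{i+1}};$$ then $o_i:=-1$, $o_{i+1}:=+1$, $a_i:=a_{i+1}:=1$. Consider a run of the method for all times $t\ge 0$ that starts either with the robots deployed (all $a_i(0)=1$, no boundary known except $y_n=L$, and the communication zones $[p_i(0)-r_i,p_i(0)+r_i]$ are non-overlapping parts of the line from $0$ to $L$), or with all boundaries known, every communication zone inside the region of its robot, and every stopped robot at its right or left boundary. Let $$t_\star=\frac{L-2\sum_{j=1}^n r_j}{\sum_{j=1}^n v_j},\qquad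 y_i^\star=\sum_{j\le i}(v_jt_\star+2r_j).$$ **Theorem.** Let $n\ge 1$. Assume that the orientations are balanced, i.e. as many robots have $o_i(0)=+1$ as have $o_i(0)=-1$ (so both numbers are $n/2$), and that at some time $t_0$ all boundaries are known and all regions have the common traversing time, $e_i(t_0)=t_\star$ for all $i$. Then from $t_0$ on $y_i=y_i^\star$ and $e_i=t_\star$ for all $i$, and there is a time $T\ge t_0$ such that: 1. for every $m=0,1,2,\dots$ there are exactly $n/2$ meetings at time $T+mt_\star$, and every robot takes part in exactly one of them; there are no other meetings at times $t\ge T$; 2. after $T$, the revisiting time is $t_{\mathrm{rev}}=2t_\star$: for every robot $i$, every point $c$ of its path $[y_{i-1}^\star+r_i,\,y_i^\star-r_i]$ and either orientation, the times $t>T$ at which robot $i$ is at $c$ with this orientation are exactly $t_1,\,t_1+2t_\star,\,t_1+4t_\star,\dots$ for some $t_1\in(T,T+2t_\star]$. Likewise, every point of $[0,L]$ lies in some region $[y_{i-1}^\star,y_i^\star]$, and for every point $c$ of this region and either orientation, the times $t>T$ at which robot $i$, with this orientation, begins to have $c$ in its communication zone form such a sequence with difference $2t_\star$. (At the instant at which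 a robot reverses, it counts as having both orientations.) -/

import Mathlib

/-- A team of `n` robots on a cycle of length `L`: communication radii `r i ≥ 0` and maximum
speeds `v i > 0`. Robots are indexed by `Fin n` (so indices are cyclic: `i + 1` is the right
neighbour and `i - 1` the left neighbour of robot `i`), sorted from left to right; robot `0` is
the first and the robot `i` with `i + 1 = 0` is the last one. The cycle cannot be covered by robots
at static positions. -/
structure Team (n : ℕ) where
  L : ℝ
  r : Fin n → ℝ
  v : Fin n → ℝ
  r_nonneg : ∀ i, 0 ≤ r i
  v_pos : ∀ i, 0 < v i
  not_covered : 2 * ∑ i, r i < L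

/-- State of the team: positions `p`, orientations `o`, activities `a` (`true` is moving, `false` is
stopped), and boundaries `y`: `y i` is the boundary between robots `i` and `i + 1`, `none` as long
as it is unknown. -/
@[ext] structure RobotState (n : ℕ) where
  p : Fin n → ℝ
  o : Fin n → ℤˣ
  a : Fin n → Bool
  y : Fin n → Option ℝ

/-- The events of the method; the index `i` of the first three and of `meeting` denotes the
pair of robots `i`, `i + 1`. -/
inductive RobotEvent (n : ℕ) where
  /-- robots `i` and `i + 1`, moving towards each other, discover their common boundary -/
  | discovery (i : Fin n)
  /-- robot `i`, moving forward, catches robot `i + 1` -/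
  | catchForward (i : Fin n)
  /-- robot `i + 1`, moving backward, catches robot `i` -/
  | catchBackward (i : Fin n)
  /-- robot `i` arrives at its right boundary `y i` -/
  | arrivalRight (i : Fin n)
  /-- robot `i` arrives at its left boundary -/
  | arrivalLeft (i : Fin n)
  /-- robots `i` and `i + 1` meet at their common boundary -/
  | meeting (i : Fin n)

namespace RobotState

variable {n : ℕ}

/-- Number of robots with positive orientation. -/
def nPos (s : RobotState n) : ℕ := (Finset.univ.filter fun i => s.o i = 1).card

/-- Number of robots with negative orientation. -/
def nNeg (s : RobotState n) : ℕ := (Finset.univ.filter fun i => s.o i = -1).card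

/-- Balanced orientations: `n₊ = n₋` (hence both are `n / 2`). -/
def Balanced (s : RobotState n) : Prop := s.nPos = s.nNeg

/-- The left boundary of robot `i`. On the line from `0` to `L` that represents the cycle, the left
boundary of the first robot is the position `0` (which is the same point as `L`). -/
def left [NeZero n] (s : RobotState n) (i : Fin n) : Option ℝ :=
  if i = 0 then some 0 else s.y (i - 1)

end RobotState

namespace Team

variable {n : ℕ} (R : Team n)

/-- The common traversing time `t⋆ = (L - 2 ∑ r) / ∑ v`. -/
noncomputable def tStar : ℝ := (R.L - 2 * ∑ i, R.r i) / ∑ i, R.v i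

/-- The goal length `d⋆ i` of the region of robot `i`. -/
noncomputable def dStar (i : Fin n) : ℝ := R.v i * R.tStar + 2 * R.r i

/-- The goal boundary `y⋆ i = d⋆ 1 + ⋯ + d⋆ i` to the right of robot `i`. -/
noncomputable def yStar (i : Fin n) : ℝ := ∑ j ∈ Finset.Iic i, R.dStar j

/-- The goal boundary to the left of robot `i` (it is `0` for the first robot). -/
noncomputable def leftStar (i : Fin n) : ℝ := ∑ j ∈ Finset.Iio i, R.dStar j

/-- Motion for a duration `δ` without events: `ṗ i = v i * a i * o i`, everything else constant. -/
def flow (s : RobotState n) (δ : ℝ) : RobotState n :=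
  { s with p := fun i => s.p i + δ * (R.v i * (if s.a i then 1 else 0) * ((s.o i : ℤ) : ℝ)) }

variable [NeZero n]

/-- The communication zones of robots `i` and `i + 1` are in touch. -/
def InTouch (s : RobotState n) (i : Fin n) : Prop :=
  s.p i + R.r i = s.p (i + 1) - R.r (i + 1)

/-- Robot `i` is oriented forward and its communication zone touches its right boundary. -/
def AtRight (s : RobotState n) (i : Fin n) : Prop :=
  s.o i = 1 ∧ s.y i = some (s.p i + R.r i)

/-- Robot `i` is oriented backward and its communication zone touches its left boundary. -/
def AtLeft (s : RobotState n) (i : Fin n) : Prop :=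
  s.o i = -1 ∧ s.left i = some (s.p i - R.r i)

/-- The conditions under which an event takes place. -/
def Enabled (s : RobotState n) : RobotEvent n → Prop
  | .discovery i => s.y i = none ∧ s.a i = true ∧ s.a (i + 1) = true ∧
      s.o i = 1 ∧ s.o (i + 1) = -1 ∧ R.InTouch s i
  | .catchForward i => s.y i = none ∧ s.a i = true ∧ s.o i = 1 ∧ s.o (i + 1) = 1 ∧
      (s.a (i + 1) = false ∨ R.v (i + 1) < R.v i) ∧ R.InTouch s i
  | .catchBackward i => s.y i = none ∧ s.a (i + 1) = true ∧ s.o i = -1 ∧ s.o (i + 1) = -1 ∧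
      (s.a i = false ∨ R.v i < R.v (i + 1)) ∧ R.InTouch s i
  | .arrivalRight i => s.a i = true ∧ R.AtRight s i ∧ ¬ R.AtLeft s (i + 1)
  | .arrivalLeft i => s.a i = true ∧ R.AtLeft s i ∧ ¬ R.AtRight s (i - 1)
  | .meeting i => R.AtRight s i ∧ R.AtLeft s (i + 1)

/-- The common boundary of robots `i` and `i + 1` after their meeting. The boundary between the
last and the first robot is fixed; the others are recomputed from the outer boundaries of the two
robots, as soon as these are both known. -/
noncomputable def updatedBoundary (s : RobotState n) (i : Fin n) : Option ℝ :=
  if i + 1 = 0 then s.y i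
  else match s.left i, s.y (i + 1) with
    | some u, some w => some
        ((R.v (i + 1) * (u + 2 * R.r i) + R.v i * (w - 2 * R.r (i + 1))) / (R.v i + R.v (i + 1)))
    | _, _ => s.y i

/-- The state after an event. -/
noncomputable def afterEvent (s : RobotState n) : RobotEvent n → RobotState n
  | .discovery i =>
      { s with
        y := Function.update s.y i (some (s.p i + R.r i))
        o := Function.update (Function.update s.o i (-1)) (i + 1) 1 }
  | .catchForward i =>
      { s with
        y := Function.update s.y i (some (s.p i + R.r i))
        a := Function.update (Function.update s.a i false) (i + 1) true }
  | .catchBackward i =>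
      { s with
        y := Function.update s.y i (some (s.p i + R.r i))
        a := Function.update (Function.update s.a i true) (i + 1) false }
  | .arrivalRight i => { s with a := Function.update s.a i false }
  | .arrivalLeft i => { s with a := Function.update s.a i false }
  | .meeting i =>
      { s with
        y := Function.update s.y i (R.updatedBoundary s i)
        o := Function.update (Function.update s.o i (-1)) (i + 1) 1
        a := Function.update (Function.update s.a i true) (i + 1) true }

/-- Initial deployment: all robots are active, their communication zones are non-overlapping
parts of the line from `0` to `L`, in the order of the indices, and the only known boundary is the
fixed one at `L` between the last and the first robot. -/
def Deployed (s : RobotState n) : Prop :=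
  (∀ i, s.a i = true) ∧
  (∀ i, s.y i = if i + 1 = 0 then some R.L else none) ∧
  0 ≤ s.p 0 - R.r 0 ∧
  (∀ i, i + 1 ≠ 0 → s.p i + R.r i ≤ s.p (i + 1) - R.r (i + 1)) ∧
  (∀ i, i + 1 = 0 → s.p i + R.r i ≤ R.L)

/-- A state of a team that already knows all its boundaries: every robot has its
communication zone inside its region, at an arbitrary place and with an arbitrary orientation, and is
moving or waits at the boundary it is oriented to. -/
def InRegions (s : RobotState n) : Prop :=
  (∀ i, i + 1 = 0 → s.y i = some R.L) ∧
  ∀ i, (∃ u w, s.left i = some u ∧ s.y i = some w ∧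
      u ≤ s.p i - R.r i ∧ s.p i + R.r i ≤ w) ∧
    (s.a i = false → R.AtRight s i ∨ R.AtLeft s i)

/-- All boundaries are known, and the traversing time `e i = (d i - 2 r i) / v i` of every robot,
with `d i` the length of its region, is the common traversing time. -/
def CommonTraversingTimes (s : RobotState n) : Prop :=
  ∀ i, ∃ u w, s.left i = some u ∧ s.y i = some w ∧ (w - u - 2 * R.r i) / R.v i = R.tStar

/-- An execution of the method for all times `t ≥ 0`. `state k` is the state right after the `k`-th
event, at time `time k` (`state 0` is the state at time `0`); `event k` is the event that leads
from `state k` to `state (k + 1)`, at time `time (k + 1)`. Events take place as soon as they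
are possible; simultaneous ones are executed one after the other, in any order. -/
structure Execution where
  time : ℕ → ℝ
  state : ℕ → RobotState n
  event : ℕ → RobotEvent n
  time_zero : time 0 = 0
  time_mono : Monotone time
  time_unbounded : Filter.Tendsto time Filter.atTop Filter.atTop
  not_enabled : ∀ k, ∀ δ, 0 ≤ δ → δ < time (k + 1) - time k →
    ∀ ε, ¬ R.Enabled (R.flow (state k) δ) ε
  enabled : ∀ k, R.Enabled (R.flow (state k) (time (k + 1) - time k)) (event k)
  state_succ : ∀ k,
    state (k + 1) = R.afterEvent (R.flow (state k) (time (k + 1) - time k)) (event k)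

namespace Execution

variable {R}
variable (x : R.Execution)

/-- The team is in state `s` at time `t`. At the time of an event these are the states before and
after it, so a robot that reverses at time `t` has both orientations then. -/
def StateAt (t : ℝ) (s : RobotState n) : Prop :=
  ∃ k, x.time k ≤ t ∧ t ≤ x.time (k + 1) ∧ s = R.flow (x.state k) (t - x.time k)

/-- Robots `i` and `i + 1` meet at time `t`. -/
def MeetingAt (i : Fin n) (t : ℝ) : Prop :=
  ∃ k, x.time (k + 1) = t ∧ x.event k = .meeting i

/-- The times at which robot `i` is at the point `c` with orientation `ε`. -/
def positionTimes (i : Fin n) (c : ℝ) (ε : ℤˣ) : Set ℝ :=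
  {t | ∃ s, x.StateAt t s ∧ s.p i = c ∧ s.o i = ε}

/-- The times at which the point `c` is in the communication zone of robot `i`, and robot `i` has
orientation `ε`. -/
def zoneTimes (i : Fin n) (c : ℝ) (ε : ℤˣ) : Set ℝ :=
  {t | ∃ s, x.StateAt t s ∧ |s.p i - c| ≤ R.r i ∧ s.o i = ε}

/-- The times at which robot `i` begins to have `c` in its communication zone with
orientation `ε`. -/
def zoneArrivalTimes (i : Fin n) (c : ℝ) (ε : ℤˣ) : Set ℝ :=
  {t | t ∈ x.zoneTimes i c ε ∧ ∃ δ > 0, ∀ t' ∈ Set.Ioo (t - δ) t, t' ∉ x.zoneTimes i c ε}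

end Execution

end Team

/-- After time `T`, the elements of `A` are exactly the terms of an arithmetic progression with
difference `P`, the first of which is at most `T + P`. -/
def RecursEvery (A : Set ℝ) (T P : ℝ) : Prop :=
  ∃ t₁ ∈ Set.Ioc T (T + P), ∀ t > T, t ∈ A ↔ ∃ m : ℕ, t = t₁ + m * P

/-!
Equal traversing times are a fixed point of the boundary updates, so from `t₀` on the regions do not
change. What matters then is only, for each robot, its orientation and a timer: the time it needs to
the boundary it is oriented to. This timer runs down to zero, stays there while the robot waits, and
is set to `t⋆` by a meeting (`Team.Execution.relay`). That timers are never negative, although the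
method may start with unknown boundaries, is the invariant `Team.Consistent`.

Since the orientations are balanced, the boundaries carry integer heights such that two consecutive
ones differ by the orientation of the robot in between (`Relay.height`). Robots meet only at a
boundary that is a local minimum of the height, and the meeting raises it by `2`. Hence the level
of a robot, the height of the boundary it is oriented to, grows by `1` at each of its meetings, and
equals the level of the robot it meets. Let the delay of a robot be the time at which it is due at
this boundary minus `t⋆` times its level. Meetings leave the delays unchanged and waiting makes them
grow, but a robot with the largest delay never waits: a waiting robot has a neighbour with a larger
delay (`Relay.delay_le_succ_of_le`). So the largest delay `M` is constant, and a robot that has this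
delay keeps it. Robots that meet have the same delay, so `M` spreads from neighbour to neighbour
until all robots have it (`Relay.exists_settled`).

From then on nobody waits, and all meetings are at times `M + c * t⋆` with an integer `c`. As timers
are at most `t⋆`, between two such times all robots have the same level, hence every robot meets a
neighbour at each of them (`Relay.exists_schedule`). Each robot traverses its region back and forth
in rounds of duration `t⋆`, with alternating orientation, which gives the revisiting time `2 * t⋆`
for points of its path and, since its zone covers a point during one interval of timer values, for
the arrivals of the zone.
-/

/-! ### The invariant, and motion without events -/

namespace RobotState

variable {n : ℕ} [NeZero n]

theorem left_zero (s : RobotState n) : s.left 0 = some 0 := if_pos rfl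

theorem left_add_one (s : RobotState n) {i : Fin n} (hi : i + 1 ≠ 0) : s.left (i + 1) = s.y i := by
  simp [left, hi]

end RobotState

/-- A nonnegative quantity that changes linearly and ends up negative has passed through zero at an
earlier moment. -/
theorem exists_zero_of_linear {g w Δ : ℝ} (hg : 0 ≤ g) (hΔ : 0 ≤ Δ) (h : g + Δ * w < 0) :
    w < 0 ∧ ∃ δ, 0 ≤ δ ∧ δ < Δ ∧ g + δ * w = 0 := by
  have hw : w < 0 := by
    by_contra hw
    nlinarith [mul_nonneg hΔ (not_lt.1 hw)]
  refine ⟨hw, g / -w, div_nonneg hg (by linarith), ?_, ?_⟩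
  · rw [div_lt_iff₀ (by linarith)]
    linarith
  · have := hw.ne
    field_simp
    ring

namespace Team

section

variable {n : ℕ} (R : Team n)

/-- The signed velocity `v i * a i * o i` of robot `i`. -/
def velocity (s : RobotState n) (i : Fin n) : ℝ :=
  R.v i * (if s.a i then 1 else 0) * ((s.o i : ℤ) : ℝ)

theorem flow_p (s : RobotState n) (δ : ℝ) (i : Fin n) :
    (R.flow s δ).p i = s.p i + δ * R.velocity s i := rfl

theorem velocity_nonneg {s : RobotState n} {i : Fin n} (h : s.o i = 1 ∨ s.a i = false) :
    0 ≤ R.velocity s i := by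
  have := R.v_pos i
  rcases h with h | h <;> simp [velocity, h]
  split_ifs <;> linarith

theorem velocity_nonpos {s : RobotState n} {i : Fin n} (h : s.o i = -1 ∨ s.a i = false) :
    R.velocity s i ≤ 0 := by
  have := R.v_pos i
  rcases h with h | h <;> simp [velocity, h]
  split_ifs <;> linarith

end

variable {n : ℕ} [NeZero n] (R : Team n)

/-- The invariant of the method, from either kind of start. A robot is only required to respect
the boundary it is heading for, or one whose counterpart on its other side is unknown: when a meeting
moves a known boundary, a robot that has just turned away from it may be left outside its region. -/
structure Consistent (s : RobotState n) : Prop where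
  last_known : ∀ i, i + 1 = 0 → s.y i ≠ none
  length_le : ∀ i u w, s.left i = some u → s.y i = some w → u + 2 * R.r i ≤ w
  left_le : ∀ i u, s.left i = some u → s.o i = -1 ∨ s.y i = none → u ≤ s.p i - R.r i
  le_right : ∀ i w, s.y i = some w → s.o i = 1 ∨ s.left i = none → s.p i + R.r i ≤ w
  ordered : ∀ i, s.y i = none → s.p i + R.r i ≤ s.p (i + 1) - R.r (i + 1)
  waiting : ∀ i, s.a i = false → R.AtRight s i ∨ R.AtLeft s i

theorem Deployed.consistent {R : Team n} (h1 : (1 : Fin n) ≠ 0) {s : RobotState n}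
    (h : R.Deployed s) : R.Consistent s := by
  obtain ⟨ha, hy, h0, hord, hL⟩ := h
  have hleft : ∀ i u, s.left i = some u → i = 0 ∧ u = 0 := by
    intro i u hu
    by_cases hi : i = 0
    · subst hi
      rw [s.left_zero] at hu
      exact ⟨rfl, (Option.some.inj hu).symm⟩
    · rw [RobotState.left, if_neg hi, hy, if_neg (by simpa using hi)] at hu
      cases hu
  have hright : ∀ i w, s.y i = some w → i + 1 = 0 ∧ w = R.L := by
    intro i w hw
    rw [hy] at hw
    split_ifs at hw with hi
    exact ⟨hi, (Option.some.inj hw).symm⟩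
  refine ⟨fun i hi => by simp [hy, hi], ?_, ?_, ?_, ?_, fun i hi => by simp [ha] at hi⟩
  · intro i u w hu hw
    have h2 := (hright i w hw).1
    rw [(hleft i u hu).1, zero_add] at h2
    exact absurd h2 h1
  · intro i u hu _
    obtain ⟨rfl, rfl⟩ := hleft i u hu
    exact h0
  · intro i w hw _
    obtain ⟨hi, rfl⟩ := hright i w hw
    exact hL i hi
  · intro i hi
    refine hord i fun h => ?_
    simp [hy, h] at hi

theorem InRegions.consistent {R : Team n} {s : RobotState n} (h : R.InRegions s) :
    R.Consistent s := by
  obtain ⟨hL, h⟩ := h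
  have hy : ∀ i, s.y i ≠ none := by
    intro i hi
    obtain ⟨⟨u, w, -, hw, -⟩, -⟩ := h i
    rw [hi] at hw
    cases hw
  have hb : ∀ i u, s.left i = some u → u ≤ s.p i - R.r i := by
    intro i u hu
    obtain ⟨⟨u', w', hu', -, h1, -⟩, -⟩ := h i
    rw [hu] at hu'
    cases hu'
    exact h1
  have hb' : ∀ i w, s.y i = some w → s.p i + R.r i ≤ w := by
    intro i u hu
    obtain ⟨⟨u', w', -, hu', -, h1⟩, -⟩ := h i
    rw [hu] at hu'
    cases hu'
    exact h1
  exact ⟨fun i _ => hy i, fun i u w hu hw => by linarith [hb i u hu, hb' i w hw],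
    fun i u hu _ => hb i u hu, fun i w hw _ => hb' i w hw, fun i hi => absurd hi (hy i),
    fun i => (h i).2⟩

theorem exists_enabled_of_atRight {s : RobotState n} {i : Fin n} (ha : s.a i = true)
    (h : R.AtRight s i) : ∃ ε, R.Enabled s ε := by
  by_cases h' : R.AtLeft s (i + 1)
  · exact ⟨.meeting i, h, h'⟩
  · exact ⟨.arrivalRight i, ha, h, h'⟩

theorem exists_enabled_of_atLeft {s : RobotState n} {i : Fin n} (ha : s.a i = true)
    (h : R.AtLeft s i) : ∃ ε, R.Enabled s ε := by
  by_cases h' : R.AtRight s (i - 1)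
  · exact ⟨.meeting (i - 1), h', by simpa using h⟩
  · exact ⟨.arrivalLeft i, ha, h, h'⟩

theorem Consistent.flow {R : Team n} {s : RobotState n} (hs : R.Consistent s) {Δ : ℝ} (hΔ : 0 ≤ Δ)
    (hne : ∀ δ, 0 ≤ δ → δ < Δ → ∀ ε, ¬ R.Enabled (R.flow s δ) ε) :
    R.Consistent (R.flow s Δ) := by
  have horient : ∀ i, s.o i = 1 ∨ s.o i = -1 := fun i => Int.units_eq_one_or _
  refine ⟨hs.last_known, hs.length_le, ?_, ?_, ?_, ?_⟩
  · intro i u (hu : s.left i = some u) (ho : s.o i = -1 ∨ s.y i = none)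
    have h0 := hs.left_le i u hu ho
    rw [flow_p]
    by_contra hlt
    obtain ⟨hw, δ, hδ, hδΔ, h⟩ := exists_zero_of_linear (g := s.p i - R.r i - u)
      (w := R.velocity s i) (by linarith) hΔ (by linarith)
    have hneg : s.o i ≠ 1 ∧ s.a i = true := by
      constructor
      · exact fun h => absurd (R.velocity_nonneg (Or.inl h)) (by linarith)
      · by_contra h
        exact absurd (R.velocity_nonneg (Or.inr (by simpa using h))) (by linarith)
    have ho' : s.o i = -1 := (horient i).resolve_left hneg.1
    obtain ⟨ε, hε⟩ := R.exists_enabled_of_atLeft (s := R.flow s δ) (i := i) hneg.2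
      ⟨ho', by rw [flow_p]; exact hu.trans (by congr 1; linarith)⟩
    exact hne δ hδ hδΔ ε hε
  · intro i u (hu : s.y i = some u) (ho : s.o i = 1 ∨ s.left i = none)
    have h0 := hs.le_right i u hu ho
    rw [flow_p]
    by_contra hlt
    obtain ⟨hw, δ, hδ, hδΔ, h⟩ := exists_zero_of_linear (g := u - s.p i - R.r i)
      (w := -R.velocity s i) (by linarith) hΔ (by linarith)
    have hneg : s.o i ≠ -1 ∧ s.a i = true := by
      constructor
      · exact fun h => absurd (R.velocity_nonpos (Or.inl h)) (by linarith)
      · by_contra h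
        exact absurd (R.velocity_nonpos (Or.inr (by simpa using h))) (by linarith)
    have ho' : s.o i = 1 := (horient i).resolve_right hneg.1
    obtain ⟨ε, hε⟩ := R.exists_enabled_of_atRight (s := R.flow s δ) (i := i) hneg.2
      ⟨ho', by rw [flow_p]; exact hu.trans (by congr 1; linarith)⟩
    exact hne δ hδ hδΔ ε hε
  · intro i (hi : s.y i = none)
    have hi0 : i + 1 ≠ 0 := fun h => hs.last_known i h hi
    have hl : s.left (i + 1) = none := by rw [s.left_add_one hi0, hi]
    rw [flow_p, flow_p]
    by_contra hlt
    obtain ⟨hw, δ, hδ, hδΔ, h⟩ := exists_zero_of_linear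
      (g := s.p (i + 1) - R.r (i + 1) - (s.p i + R.r i))
      (w := R.velocity s (i + 1) - R.velocity s i)
      (by linarith [hs.ordered i hi]) hΔ (by linarith)
    have htouch : R.InTouch (R.flow s δ) i := by
      rw [InTouch, flow_p, flow_p]
      linarith
    -- a robot that waits does so at a known boundary
    have ha : s.o i = 1 → s.a i = true := by
      intro ho
      by_contra h
      rcases hs.waiting i (by simpa using h) with h' | h'
      · exact absurd (hi.symm.trans h'.2) (by simp)
      · exact absurd (ho.symm.trans h'.1) (by decide)
    have ha' : s.o (i + 1) = -1 → s.a (i + 1) = true := by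
      intro ho
      by_contra h
      rcases hs.waiting (i + 1) (by simpa using h) with h' | h'
      · exact absurd (ho.symm.trans h'.1) (by decide)
      · exact absurd (hl.symm.trans h'.2) (by simp)
    -- whatever their orientations are, robots in touch that approach each other cause an event
    have key : ∃ ε, R.Enabled (R.flow s δ) ε := by
      rcases horient i with ho | ho <;> rcases horient (i + 1) with ho' | ho'
      · refine ⟨.catchForward i, hi, ha ho, ho, ho', ?_, htouch⟩
        show s.a (i + 1) = false ∨ _
        by_contra! hcon
        have h1 : s.a (i + 1) = true := by simpa using hcon.1
        simp [velocity, ho, ho', ha ho, h1] at hw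
        linarith [hcon.2]
      · exact ⟨.discovery i, hi, ha ho, ha' ho', ho, ho', htouch⟩
      · linarith [R.velocity_nonneg (Or.inl ho'), R.velocity_nonpos (Or.inl ho)]
      · refine ⟨.catchBackward i, hi, ha' ho', ho, ho', ?_, htouch⟩
        show s.a i = false ∨ _
        by_contra! hcon
        have h1 : s.a i = true := by simpa using hcon.1
        simp [velocity, ho, ho', ha' ho', h1] at hw
        linarith [hcon.2]
    obtain ⟨ε, hε⟩ := key
    exact hne δ hδ hδΔ ε hε
  · intro i (hi : s.a i = false)
    have hp : (R.flow s Δ).p i = s.p i := by simp [flow_p, velocity, hi]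
    rw [AtRight, AtLeft, hp]
    exact hs.waiting i hi

end Team

/-! ### The invariant under events -/

namespace RobotState

variable {n : ℕ} [NeZero n]

theorem left_of_update {s s' : RobotState n} {i : Fin n} {b : Option ℝ}
    (hy : s'.y = Function.update s.y i b) (hi : i + 1 ≠ 0) (j : Fin n) :
    s'.left j = if j = i + 1 then b else s.left j := by
  by_cases hj : j = i + 1
  · rw [if_pos hj, hj, s'.left_add_one hi, hy, Function.update_self]
  · have h : j - 1 ≠ i := fun h => hj (sub_eq_iff_eq_add.1 h)
    rw [if_neg hj, left, left, hy, Function.update_of_ne h]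

end RobotState

namespace Team

variable {n : ℕ} [NeZero n] {R : Team n} {s s' : RobotState n} {i : Fin n}

/-- The common part of a discovery and of the two kinds of catch: the boundary between two robots in
touch becomes known at the point of contact. -/
theorem Consistent.reveal (h1 : (1 : Fin n) ≠ 0) (hs : R.Consistent s) (hi : s.y i = none)
    (ht : R.InTouch s i) (hp : s'.p = s.p) (hy : s'.y = Function.update s.y i (some (s.p i + R.r i)))
    (ho : ∀ j, j ≠ i → j ≠ i + 1 → s'.o j = s.o j) (ha : ∀ j, j ≠ i → j ≠ i + 1 → s'.a j = s.a j)
    (hwait : s'.a i = false → R.AtRight s' i)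
    (hwait' : s'.a (i + 1) = false → R.AtLeft s' (i + 1)) : R.Consistent s' := by
  have hi0 : i + 1 ≠ 0 := fun h => hs.last_known i h hi
  have hii : i ≠ i + 1 := fun h => h1 (by simpa using h.symm)
  have hl := RobotState.left_of_update hy hi0
  have hlnone : s.left (i + 1) = none := by rw [s.left_add_one hi0, hi]
  have hyi : s'.y i = some (s.p i + R.r i) := by simp [hy]
  have hyj : ∀ j, j ≠ i → s'.y j = s.y j := fun j hj => by simp [hy, hj]
  have hli : s'.left (i + 1) = some (s.p i + R.r i) := by simp [hl]
  have hlj : ∀ j, j ≠ i + 1 → s'.left j = s.left j := fun j hj => by simp [hl, hj]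
  rw [InTouch] at ht
  refine ⟨?_, ?_, ?_, ?_, ?_, ?_⟩
  · intro j hj
    by_cases hji : j = i
    · simp [hji, hyi]
    · simpa [hyj j hji] using hs.last_known j hj
  · intro j u w hu hw
    by_cases hji : j = i
    · subst hji
      rw [hlj j hii] at hu
      rw [hyi] at hw
      cases hw
      linarith [hs.left_le j u hu (Or.inr hi)]
    · rw [hyj j hji] at hw
      by_cases hji' : j = i + 1
      · subst hji'
        rw [hli] at hu
        cases hu
        linarith [hs.le_right _ w hw (Or.inr hlnone)]
      · rw [hlj j hji'] at hu
        exact hs.length_le j u w hu hw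
  · intro j u hu hc
    rw [hp]
    by_cases hji' : j = i + 1
    · subst hji'
      rw [hli] at hu
      cases hu
      exact ht.le
    · rw [hlj j hji'] at hu
      by_cases hji : j = i
      · exact hs.left_le j u hu (Or.inr (hji ▸ hi))
      · rw [ho j hji hji', hyj j hji] at hc
        exact hs.left_le j u hu hc
  · intro j w hw hc
    rw [hp]
    by_cases hji : j = i
    · subst hji
      rw [hyi] at hw
      cases hw
      exact le_rfl
    · rw [hyj j hji] at hw
      by_cases hji' : j = i + 1
      · exact hs.le_right j w hw (Or.inr (hji' ▸ hlnone))
      · rw [ho j hji hji', hlj j hji'] at hc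
        exact hs.le_right j w hw hc
  · intro j hj
    have hji : j ≠ i := by
      rintro rfl
      simp [hyi] at hj
    rw [hp]
    exact hs.ordered j (hyj j hji ▸ hj)
  · intro j hj
    by_cases hji : j = i
    · subst hji
      exact Or.inl (hwait hj)
    by_cases hji' : j = i + 1
    · subst hji'
      exact Or.inr (hwait' hj)
    rw [ha j hji hji'] at hj
    rw [AtRight, AtLeft, hp, ho j hji hji', hyj j hji, hlj j hji']
    exact hs.waiting j hj

/-- The part of a meeting in which the two robots turn round. -/
theorem Consistent.turn (h1 : (1 : Fin n) ≠ 0) (hs : R.Consistent s) (hr : R.AtRight s i)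
    (hl : R.AtLeft s (i + 1)) : R.Consistent { s with
      o := Function.update (Function.update s.o i (-1)) (i + 1) 1
      a := Function.update (Function.update s.a i true) (i + 1) true } := by
  have hii : i ≠ i + 1 := fun h => h1 (by simpa using h.symm)
  refine ⟨hs.last_known, hs.length_le, ?_, ?_, hs.ordered, ?_⟩
  · intro j u (hu : s.left j = some u) hc
    by_cases hji : j = i
    · subst hji
      have := hs.length_le j u _ hu hr.2
      show u ≤ s.p j - R.r j
      linarith
    by_cases hji' : j = i + 1
    · refine hs.left_le j u hu (Or.inr (hc.resolve_left ?_))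
      simp [hji']
    · refine hs.left_le j u hu (hc.imp_left fun h => ?_)
      simpa [hji, hji'] using h
  · intro j w (hw : s.y j = some w) hc
    by_cases hji' : j = i + 1
    · subst hji'
      have := hs.length_le _ _ w hl.2 hw
      show s.p (i + 1) + R.r (i + 1) ≤ w
      linarith
    by_cases hji : j = i
    · refine hs.le_right j w hw (Or.inr (hc.resolve_left ?_))
      simp [hji, hii]
    · refine hs.le_right j w hw (hc.imp_left fun h => ?_)
      simpa [hji, hji'] using h
  · intro j hj
    by_cases hji' : j = i + 1
    · simp [hji'] at hj
    by_cases hji : j = i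
    · simp [hji, hii] at hj
    have := hs.waiting j (by simpa [hji, hji'] using hj)
    simpa [AtRight, AtLeft, hji, hji', RobotState.left] using this

/-- The part of a meeting in which the common boundary moves: both robots are heading away from it, so
only the lengths of the two regions matter. -/
theorem Consistent.move_boundary (h1 : (1 : Fin n) ≠ 0) (hs : R.Consistent s) (hi0 : i + 1 ≠ 0)
    (hoi : s.o i = -1) (hoi' : s.o (i + 1) = 1) (hai : s.a i = true) (hai' : s.a (i + 1) = true)
    {u w b : ℝ} (hu : s.left i = some u) (hw : s.y (i + 1) = some w)
    (hub : u + 2 * R.r i ≤ b) (hbw : b + 2 * R.r (i + 1) ≤ w) :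
    R.Consistent { s with y := Function.update s.y i (some b) } := by
  set s' : RobotState n := { s with y := Function.update s.y i (some b) } with hs'
  have hii : i ≠ i + 1 := fun h => h1 (by simpa using h.symm)
  have hl := RobotState.left_of_update (s' := s') (s := s) (b := some b) rfl hi0
  have hyi : s'.y i = some b := by simp [hs']
  have hyj : ∀ j, j ≠ i → s'.y j = s.y j := fun j hj => by simp [hs', hj]
  have hli : s'.left (i + 1) = some b := by simp [hl]
  have hlj : ∀ j, j ≠ i + 1 → s'.left j = s.left j := fun j hj => by simp [hl, hj]
  refine ⟨?_, ?_, ?_, ?_, ?_, ?_⟩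
  · intro j hj
    by_cases hji : j = i
    · simp [hji, hyi]
    · simpa [hyj j hji] using hs.last_known j hj
  · intro j u' w' hu' hw'
    by_cases hji : j = i
    · subst hji
      rw [hlj j hii, hu] at hu'
      rw [hyi] at hw'
      cases hw'
      cases hu'
      exact hub
    · rw [hyj j hji] at hw'
      by_cases hji' : j = i + 1
      · subst hji'
        rw [hli] at hu'
        rw [hw] at hw'
        cases hu'
        cases hw'
        exact hbw
      · rw [hlj j hji'] at hu'
        exact hs.length_le j u' w' hu' hw'
  · intro j u' hu' (hc : s.o j = -1 ∨ _)
    show u' ≤ s.p j - _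
    by_cases hji' : j = i + 1
    · subst hji'
      rw [hyj _ hii.symm, hw, hoi'] at hc
      exact absurd hc (by simp)
    · rw [hlj j hji'] at hu'
      by_cases hji : j = i
      · exact hs.left_le j u' hu' (Or.inl (hji ▸ hoi))
      · rw [hyj j hji] at hc
        exact hs.left_le j u' hu' hc
  · intro j w' hw' (hc : s.o j = 1 ∨ _)
    show s.p j + _ ≤ w'
    by_cases hji : j = i
    · subst hji
      rw [hlj _ hii, hu, hoi] at hc
      exact absurd hc (by simp)
    · rw [hyj j hji] at hw'
      by_cases hji' : j = i + 1
      · exact hs.le_right j w' hw' (Or.inl (hji' ▸ hoi'))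
      · rw [hlj j hji'] at hc
        exact hs.le_right j w' hw' hc
  · intro j hj
    have hji : j ≠ i := by
      rintro rfl
      simp [hyi] at hj
    exact hs.ordered j (hyj j hji ▸ hj)
  · intro j (hj : s.a j = false)
    have hji : j ≠ i := by
      rintro rfl
      simp [hai] at hj
    have hji' : j ≠ i + 1 := by
      rintro rfl
      simp [hai'] at hj
    rw [AtRight, AtLeft, hyj j hji, hlj j hji']
    exact hs.waiting j hj

theorem Consistent.arrive (hs : R.Consistent s) (hi : R.AtRight s i ∨ R.AtLeft s i) :
    R.Consistent { s with a := Function.update s.a i false } := by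
  refine ⟨hs.last_known, hs.length_le, hs.left_le, hs.le_right, hs.ordered, fun j hj => ?_⟩
  by_cases hji : j = i
  · subst hji
    exact hi
  · exact hs.waiting j (by simpa [hji] using hj)

theorem Consistent.meeting (h1 : (1 : Fin n) ≠ 0) (hs : R.Consistent s) (hr : R.AtRight s i)
    (hl : R.AtLeft s (i + 1)) : R.Consistent (R.afterEvent s (.meeting i)) := by
  have hturn := hs.turn h1 hr hl
  have hii : i ≠ i + 1 := fun h => h1 (by simpa using h.symm)
  have hsame : R.updatedBoundary s i = s.y i → R.Consistent (R.afterEvent s (.meeting i)) := by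
    intro h
    rw [afterEvent, h, Function.update_eq_self]
    exact hturn
  by_cases hi0 : i + 1 = 0
  · exact hsame (if_pos hi0)
  · rcases hu : s.left i with _ | u
    · exact hsame (by simp [updatedBoundary, hu])
    rcases hw : s.y (i + 1) with _ | w
    · exact hsame (by simp [updatedBoundary, hw])
    have hb : R.updatedBoundary s i = some ((R.v (i + 1) * (u + 2 * R.r i) +
        R.v i * (w - 2 * R.r (i + 1))) / (R.v i + R.v (i + 1))) := by
      simp [updatedBoundary, hu, hw, hi0]
    have hv := R.v_pos i
    have hv' := R.v_pos (i + 1)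
    -- the new traversing times are equal, with a nonnegative sum of the distances to travel
    have hlen : u + 2 * R.r i ≤ w - 2 * R.r (i + 1) := by
      have hly := hl.2
      rw [s.left_add_one hi0, hr.2] at hly
      have h2 := hs.length_le i u _ hu hr.2
      have h3 := hs.length_le (i + 1) _ w hl.2 hw
      have h4 := Option.some.inj hly
      linarith
    rw [afterEvent, hb]
    refine hturn.move_boundary h1 hi0 (by simp [hii]) (by simp) (by simp [hii]) (by simp)
      hu hw ?_ ?_
    · rw [le_div_iff₀ (by linarith)]
      nlinarith
    · rw [← le_sub_iff_add_le, div_le_iff₀ (by linarith)]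
      nlinarith

theorem Consistent.afterEvent (h1 : (1 : Fin n) ≠ 0) (hs : R.Consistent s) {ε : RobotEvent n}
    (hε : R.Enabled s ε) : R.Consistent (R.afterEvent s ε) := by
  cases ε with
  | discovery i =>
    obtain ⟨hy, ha, ha', -, -, ht⟩ := hε
    refine hs.reveal h1 hy ht rfl rfl (fun j hj hj' => ?_) (fun j hj hj' => rfl) ?_ ?_
    · simp [Team.afterEvent, hj, hj']
    · exact fun h => absurd (ha.symm.trans h) (by simp)
    · exact fun h => absurd (ha'.symm.trans h) (by simp)
  | catchForward i =>
    obtain ⟨hy, ha, ho, ho', -, ht⟩ := hε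
    refine hs.reveal h1 hy ht rfl rfl (fun j hj hj' => rfl) (fun j hj hj' => ?_) ?_ ?_
    · simp [Team.afterEvent, hj, hj']
    · exact fun _ => ⟨ho, by simp [Team.afterEvent]⟩
    · simp [Team.afterEvent]
  | catchBackward i =>
    obtain ⟨hy, ha, ho, ho', -, ht⟩ := hε
    have hi0 : i + 1 ≠ 0 := fun h => hs.last_known i h hy
    have hii : i ≠ i + 1 := fun h => h1 (by simpa using h.symm)
    refine hs.reveal h1 hy ht rfl rfl (fun j hj hj' => rfl) (fun j hj hj' => ?_) ?_ ?_
    · simp [Team.afterEvent, hj, hj']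
    · simp [Team.afterEvent, hii]
    · refine fun _ => ⟨ho', ?_⟩
      rw [RobotState.left_add_one _ hi0]
      simpa [Team.afterEvent, InTouch] using ht
  | arrivalRight i => exact hs.arrive (Or.inl hε.2.1)
  | arrivalLeft i => exact hs.arrive (Or.inr hε.2.1)
  | meeting i => exact hs.meeting h1 hε.1 hε.2

end Team

/-! ### Balance, goal boundaries and timers -/

theorem Fin.Iio_eq_Iic_sub_one {n : ℕ} [NeZero n] {i : Fin n} (hi : i ≠ 0) :
    Finset.Iio i = Finset.Iic (i - 1) := by
  have h0 : 0 < i.val := Nat.pos_of_ne_zero fun h => hi (Fin.ext (by simpa using h))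
  ext j
  rw [Finset.mem_Iio, Finset.mem_Iic, Fin.lt_def, Fin.le_def, Fin.val_sub_one_of_ne_zero hi]
  omega

theorem Fin.Iic_eq_univ {n : ℕ} [NeZero n] {i : Fin n} (hi : i + 1 = 0) :
    Finset.Iic i = Finset.univ := by
  ext j
  simp only [Finset.mem_Iic, Finset.mem_univ, iff_true]
  by_contra! hij
  have hval := Fin.val_add_one_of_lt' (i := i) (by rw [Fin.lt_def] at hij; omega)
  simp [hi] at hval

theorem Fin.sum_Iic_eq_add_sum_Iio {n : ℕ} {M : Type*} [AddCommMonoid M] (f : Fin n → M)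
    (i : Fin n) : ∑ j ∈ Finset.Iic i, f j = f i + ∑ j ∈ Finset.Iio i, f j := by
  rw [← Finset.Iio_insert, Finset.sum_insert (by simp)]

namespace RobotState

variable {n : ℕ} {s : RobotState n}

theorem sum_orientations (s : RobotState n) :
    ∑ i, ((s.o i : ℤˣ) : ℤ) = (s.nPos : ℤ) - s.nNeg := by
  have h : ∀ i, ((s.o i : ℤˣ) : ℤ) =
      (if s.o i = 1 then 1 else 0) - (if s.o i = -1 then 1 else 0) := by
    intro i
    rcases Int.units_eq_one_or (s.o i) with h | h <;> simp [h]
  simp_rw [h, Finset.sum_sub_distrib, Finset.sum_boole, nPos, nNeg]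

theorem balanced_iff : s.Balanced ↔ ∑ i, ((s.o i : ℤˣ) : ℤ) = 0 := by
  rw [sum_orientations, Balanced, sub_eq_zero, Nat.cast_inj]

/-- A single robot is not balanced, so a balanced robot is not its own neighbour. -/
theorem Balanced.one_ne_zero [NeZero n] (h : s.Balanced) : (1 : Fin n) ≠ 0 := by
  intro h1
  have hn : n = 1 := Fin.one_eq_zero_iff.1 h1
  subst hn
  rw [balanced_iff] at h
  rcases Int.units_eq_one_or (s.o 0) with h' | h' <;> simp [h'] at h

end RobotState

/-- Two neighbours that turn away from each other have exchanged their orientations. -/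
theorem sum_update_exchange {n : ℕ} [NeZero n] {o : Fin n → ℤˣ} {i : Fin n} (h : o i = 1)
    (h' : o (i + 1) = -1) :
    ∑ j, ((Function.update (Function.update o i (-1)) (i + 1) 1 j : ℤˣ) : ℤ) =
      ∑ j, ((o j : ℤˣ) : ℤ) := by
  rw [← Equiv.sum_comp (Equiv.swap i (i + 1)) fun j => ((o j : ℤˣ) : ℤ)]
  refine Finset.sum_congr rfl fun j _ => ?_
  by_cases hj : j = i + 1
  · simp [hj, h]
  by_cases hj' : j = i
  · subst hj'
    simp [hj, h']
  · simp [hj, hj', Equiv.swap_apply_of_ne_of_ne]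

namespace Team

section

variable {n : ℕ} {R : Team n} {s : RobotState n} {i : Fin n}

theorem yStar_eq (R : Team n) (i : Fin n) : R.yStar i = R.leftStar i + R.dStar i := by
  rw [yStar, leftStar, Fin.sum_Iic_eq_add_sum_Iio, add_comm]

/-- The time that robot `i`, when moving, needs from its position to the goal boundary it is
oriented to. -/
noncomputable def timer (R : Team n) (s : RobotState n) (i : Fin n) : ℝ :=
  if s.o i = 1 then (R.yStar i - R.r i - s.p i) / R.v i
  else (s.p i - R.r i - R.leftStar i) / R.v i

theorem p_eq_of_forward (ho : s.o i = 1) :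
    s.p i = R.yStar i - R.r i - R.v i * R.timer s i := by
  rw [timer, if_pos ho, mul_div_cancel₀ _ (R.v_pos i).ne']
  ring

theorem p_eq_of_backward (ho : s.o i = -1) :
    s.p i = R.leftStar i + R.r i + R.v i * R.timer s i := by
  rw [timer, if_neg (by rw [ho]; decide), mul_div_cancel₀ _ (R.v_pos i).ne']
  ring

theorem timer_flow (s : RobotState n) (δ : ℝ) (i : Fin n) :
    R.timer (R.flow s δ) i = R.timer s i - if s.a i then δ else 0 := by
  have hv := (R.v_pos i).ne'
  have ho' : (R.flow s δ).o = s.o := rfl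
  rcases Int.units_eq_one_or (s.o i) with ho | ho <;> rcases ha : s.a i <;>
    simp [timer, flow_p, velocity, ho', ho, ha] <;> field_simp <;> ring

theorem timer_congr {s s' : RobotState n} (hp : s'.p i = s.p i) (ho : s'.o i = s.o i) :
    R.timer s' i = R.timer s i := by
  rw [timer, timer, hp, ho]

end

variable {n : ℕ} [NeZero n] {R : Team n} {s : RobotState n} {i : Fin n}

theorem balanced_afterEvent {ε : RobotEvent n} (hε : R.Enabled s ε) (hs : s.Balanced) :
    (R.afterEvent s ε).Balanced := by
  rw [RobotState.balanced_iff] at hs ⊢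
  cases ε with
  | discovery i => exact (sum_update_exchange hε.2.2.2.1 hε.2.2.2.2.1).trans hs
  | meeting i => exact (sum_update_exchange hε.1.1 hε.2.1).trans hs
  | _ => exact hs

theorem leftStar_zero (R : Team n) : R.leftStar 0 = 0 := by
  have : Finset.Iio (0 : Fin n) = ∅ := by
    ext j
    simp
  simp [leftStar, this]

theorem leftStar_eq (R : Team n) (hi : i ≠ 0) : R.leftStar i = R.yStar (i - 1) := by
  rw [leftStar, yStar, Fin.Iio_eq_Iic_sub_one hi]

theorem leftStar_add_one (R : Team n) (hi : i + 1 ≠ 0) : R.leftStar (i + 1) = R.yStar i := by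
  rw [leftStar_eq R hi, add_sub_cancel_right]

theorem sum_v_pos (R : Team n) : 0 < ∑ i, R.v i :=
  Finset.sum_pos (fun i _ => R.v_pos i) Finset.univ_nonempty

theorem tStar_pos (R : Team n) : 0 < R.tStar :=
  div_pos (sub_pos.2 R.not_covered) R.sum_v_pos

theorem yStar_last (R : Team n) (hi : i + 1 = 0) : R.yStar i = R.L := by
  have h : (∑ i, R.v i) * R.tStar = R.L - 2 * ∑ i, R.r i :=
    mul_div_cancel₀ _ R.sum_v_pos.ne'
  simp only [yStar, Fin.Iic_eq_univ hi, dStar, Finset.sum_add_distrib, ← Finset.sum_mul,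
    ← Finset.mul_sum, h]
  ring

/-- All boundaries are known and are at their goal positions. -/
def AtGoal (R : Team n) (s : RobotState n) : Prop :=
  ∀ i, s.left i = some (R.leftStar i) ∧ s.y i = some (R.yStar i)

/-- The left boundary of the first robot is `0`, so equal traversing times determine all boundaries
from left to right. -/
theorem CommonTraversingTimes.atGoal (h : R.CommonTraversingTimes s) : R.AtGoal s := by
  have hright : ∀ i, s.left i = some (R.leftStar i) → s.y i = some (R.yStar i) := by
    intro i hi
    obtain ⟨u, w, hu, hw, he⟩ := h i
    rw [hi] at hu
    cases hu
    rw [div_eq_iff (R.v_pos i).ne'] at he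
    rw [hw, yStar_eq, dStar]
    congr 1
    linarith
  have hleft : ∀ k : ℕ, ∀ i : Fin n, i.val = k → s.left i = some (R.leftStar i) := by
    intro k
    induction k with
    | zero =>
      intro i hi
      obtain rfl : i = 0 := Fin.ext (by simpa using hi)
      rw [s.left_zero, leftStar_zero]
    | succ k ih =>
      intro i hi
      have hi0 : i ≠ 0 := by
        rintro rfl
        simp at hi
      rw [RobotState.left, if_neg hi0, leftStar_eq R hi0]
      exact hright _ (ih (i - 1) (by rw [Fin.val_sub_one_of_ne_zero hi0]; omega))
  exact fun i => ⟨hleft _ i rfl, hright i (hleft _ i rfl)⟩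

/-- The goal boundaries are a fixed point of the recomputation at a meeting. -/
theorem updatedBoundary_eq (hs : R.AtGoal s) (i : Fin n) : R.updatedBoundary s i = s.y i := by
  by_cases hi : i + 1 = 0
  · exact if_pos hi
  · have hv := R.v_pos i
    have hv' := R.v_pos (i + 1)
    simp only [updatedBoundary, if_neg hi, (hs i).1, (hs (i + 1)).2, (hs i).2, yStar_eq R (i + 1),
      leftStar_add_one R hi]
    rw [yStar_eq R i, dStar, dStar]
    congr 1
    rw [div_eq_iff (by linarith)]
    ring

theorem AtGoal.y_ne_none (hs : R.AtGoal s) (i : Fin n) : s.y i ≠ none := by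
  simp [(hs i).2]

theorem AtGoal.afterEvent (hs : R.AtGoal s) {ε : RobotEvent n} (hε : R.Enabled s ε) :
    R.AtGoal (R.afterEvent s ε) := by
  cases ε with
  | discovery i => exact absurd hε.1 (hs.y_ne_none i)
  | catchForward i => exact absurd hε.1 (hs.y_ne_none i)
  | catchBackward i => exact absurd hε.1 (hs.y_ne_none i)
  | arrivalRight i => exact hs
  | arrivalLeft i => exact hs
  | meeting i =>
    have hy : (R.afterEvent s (.meeting i)).y = s.y := by
      rw [Team.afterEvent, updatedBoundary_eq hs, Function.update_eq_self]
    intro j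
    rw [RobotState.left, hy]
    exact hs j

theorem AtGoal.atRight_iff (hs : R.AtGoal s) :
    R.AtRight s i ↔ s.o i = 1 ∧ R.timer s i = 0 := by
  refine and_congr_right fun ho => ?_
  have hp := p_eq_of_forward (R := R) ho
  have hv := R.v_pos i
  rw [(hs i).2, Option.some_inj]
  constructor
  · intro h
    have : R.v i * R.timer s i = 0 := by linarith
    simpa [hv.ne'] using this
  · intro h
    rw [h] at hp
    linarith

theorem AtGoal.atLeft_iff (hs : R.AtGoal s) :
    R.AtLeft s i ↔ s.o i = -1 ∧ R.timer s i = 0 := by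
  refine and_congr_right fun ho => ?_
  have hp := p_eq_of_backward (R := R) ho
  have hv := R.v_pos i
  rw [(hs i).1, Option.some_inj]
  constructor
  · intro h
    have : R.v i * R.timer s i = 0 := by linarith
    simpa [hv.ne'] using this
  · intro h
    rw [h] at hp
    linarith

theorem Consistent.timer_nonneg (hc : R.Consistent s) (hs : R.AtGoal s) (i : Fin n) :
    0 ≤ R.timer s i := by
  have hv := R.v_pos i
  rcases Int.units_eq_one_or (s.o i) with ho | ho
  · rw [timer, if_pos ho]
    have := hc.le_right i _ (hs i).2 (Or.inl ho)
    exact div_nonneg (by linarith) hv.le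
  · rw [timer, if_neg (by rw [ho]; decide)]
    have := hc.left_le i _ (hs i).1 (Or.inl ho)
    exact div_nonneg (by linarith) hv.le

theorem Consistent.timer_eq_zero (hc : R.Consistent s) (hs : R.AtGoal s) (ha : s.a i = false) :
    R.timer s i = 0 := by
  rcases hc.waiting i ha with h | h
  · exact (hs.atRight_iff.1 h).2
  · exact (hs.atLeft_iff.1 h).2

/-- As long as no event occurs, a timer runs down and then stays at zero: a moving robot whose
timer runs out stops or meets its neighbour. -/
theorem timer_flow_eq_max (hc : R.Consistent s) (hs : R.AtGoal s) {δ : ℝ} (hδ : 0 ≤ δ)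
    (hne : ∀ δ', 0 ≤ δ' → δ' < δ → ∀ ε, ¬ R.Enabled (R.flow s δ') ε) (i : Fin n) :
    R.timer (R.flow s δ) i = max (R.timer s i - δ) 0 := by
  have h0 := (hc.flow hδ hne).timer_nonneg (s := R.flow s δ) hs i
  rw [timer_flow] at h0 ⊢
  rcases ha : s.a i
  · simp [hc.timer_eq_zero hs ha, hδ]
  · simpa [ha] using h0

theorem timer_after_meeting_left (h1 : (1 : Fin n) ≠ 0) (hs : R.AtGoal s) (hr : R.AtRight s i) :
    R.timer (R.afterEvent s (.meeting i)) i = R.tStar := by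
  have hii : i ≠ i + 1 := fun h => h1 (by simpa using h.symm)
  have ho : (R.afterEvent s (.meeting i)).o i ≠ 1 := by simp [afterEvent, hii]
  rw [timer, if_neg ho, div_eq_iff (R.v_pos i).ne']
  have h := Option.some.inj ((hs i).2.symm.trans hr.2)
  have h' := R.yStar_eq i
  rw [dStar] at h'
  show s.p i - _ - _ = _
  linarith

theorem timer_after_meeting_right (hs : R.AtGoal s) (hl : R.AtLeft s (i + 1)) :
    R.timer (R.afterEvent s (.meeting i)) (i + 1) = R.tStar := by
  have ho : (R.afterEvent s (.meeting i)).o (i + 1) = 1 := by simp [afterEvent]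
  rw [timer, if_pos ho, div_eq_iff (R.v_pos _).ne']
  have h := Option.some.inj ((hs (i + 1)).1.symm.trans hl.2)
  have h' := R.yStar_eq (i + 1)
  rw [dStar] at h'
  show _ - _ - s.p (i + 1) = _
  linarith

end Team

/-! ### Relays of timers: delays and their maximum -/

open Fin.CommRing in
theorem Fin.forall_of_imp_add_one {n : ℕ} [NeZero n] {p : Fin n → Prop} {a : Fin n} (ha : p a)
    (h : ∀ i, p i → p (i + 1)) (i : Fin n) : p i := by
  have hm : ∀ m : ℕ, p (a + m • 1) := by
    intro m
    induction m with
    | zero => simpa using ha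
    | succ m ih => simpa [succ_nsmul, add_assoc] using h _ ih
  have := hm (i - a).val
  have h1 : (i - a).val • (1 : Fin n) = i - a := by simp
  rw [h1] at this
  simpa using this

/-- A cyclic relay of timers: what is left of a balanced team with goal boundaries when positions are
forgotten. Robot `i` has an orientation `o k i` and a timer `τ k i ≥ 0` right after step `k`,
at time `time k`. A timer runs down and then stays at zero. Robots `i` and `i + 1` meet (`meets k i`,
in the step from `k` to `k + 1`) as soon as they face each other with both timers at zero; they turn
round, and their timers are set to `P`. -/
structure Relay (n : ℕ) [NeZero n] (P : ℝ) where
  time : ℕ → ℝ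
  o : ℕ → Fin n → ℤˣ
  τ : ℕ → Fin n → ℝ
  meets : ℕ → Fin n → Prop
  period_pos : 0 < P
  time_mono : Monotone time
  time_unbounded : Filter.Tendsto time Filter.atTop Filter.atTop
  balanced : ∑ i, ((o 0 i : ℤˣ) : ℤ) = 0
  timer_nonneg : ∀ k i, 0 ≤ τ k i
  no_meeting : ∀ k δ i, 0 ≤ δ → δ < time (k + 1) - time k → o k i = 1 → o k (i + 1) = -1 →
    τ k i ≤ δ → ¬ τ k (i + 1) ≤ δ
  of_meets : ∀ {k i}, meets k i → o k i = 1 ∧ o k (i + 1) = -1 ∧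
    τ k i ≤ time (k + 1) - time k ∧ τ k (i + 1) ≤ time (k + 1) - time k
  after_meets : ∀ {k i}, meets k i → o (k + 1) i = -1 ∧ o (k + 1) (i + 1) = 1 ∧
    τ (k + 1) i = P ∧ τ (k + 1) (i + 1) = P
  of_not_meets : ∀ {k i}, ¬ meets k i → ¬ meets k (i - 1) → o (k + 1) i = o k i ∧
    τ (k + 1) i = max (τ k i - (time (k + 1) - time k)) 0

namespace Relay

variable {n : ℕ} [NeZero n] {P : ℝ} (x : Relay n P)

open Classical in
/-- The height of the boundary between robots `i` and `i + 1`: consecutive heights differ by the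
orientation of the robot in between, which is consistent round the cycle because the orientations are
balanced. A meeting turns a local minimum of the height into a local maximum. -/
noncomputable def height : ℕ → Fin n → ℤ
  | 0 => fun i => -∑ j ∈ Finset.Iic i, ((x.o 0 j : ℤˣ) : ℤ)
  | k + 1 => fun i => height k i + if x.meets k i then 2 else 0

theorem height_succ_of_meets {k : ℕ} {i : Fin n} (h : x.meets k i) :
    x.height (k + 1) i = x.height k i + 2 := by simp [height, h]

theorem height_succ_of_not_meets {k : ℕ} {i : Fin n} (h : ¬ x.meets k i) :
    x.height (k + 1) i = x.height k i := by simp [height, h]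

theorem not_meets_add_one {k : ℕ} {i : Fin n} (h : x.meets k i) : ¬ x.meets k (i + 1) := by
  intro h'
  have := (x.of_meets h').1
  rw [(x.of_meets h).2.1] at this
  exact absurd this (by decide)

theorem height_sub_one (k : ℕ) (i : Fin n) :
    x.height k (i - 1) = x.height k i + ((x.o k i : ℤˣ) : ℤ) := by
  induction k with
  | zero =>
    simp only [height]
    rw [Fin.sum_Iic_eq_add_sum_Iio _ i]
    by_cases hi : i = 0
    · subst hi
      have h0 : Finset.Iio (0 : Fin n) = ∅ := by
        ext j
        simp
      rw [Fin.Iic_eq_univ (by simp), x.balanced, h0]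
      simp
    · rw [Fin.Iio_eq_Iic_sub_one hi]
      ring
  | succ k ih =>
    by_cases h : x.meets k i
    · have h' : ¬ x.meets k (i - 1) := fun h' => x.not_meets_add_one h' (by simpa using h)
      rw [x.height_succ_of_meets h, x.height_succ_of_not_meets h', ih, (x.of_meets h).1,
        (x.after_meets h).1]
      push_cast
      ring
    · by_cases h' : x.meets k (i - 1)
      · have h1 := (x.of_meets h').2.1
        have h2 := (x.after_meets h').2.1
        rw [sub_add_cancel] at h1 h2
        rw [x.height_succ_of_not_meets h, x.height_succ_of_meets h', ih, h1, h2]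
        push_cast
        ring
      · rw [x.height_succ_of_not_meets h, x.height_succ_of_not_meets h', ih,
          (x.of_not_meets h h').1]

theorem height_add_one (k : ℕ) (i : Fin n) :
    x.height k i = x.height k (i + 1) + ((x.o k (i + 1) : ℤˣ) : ℤ) := by
  simpa using x.height_sub_one k (i + 1)

/-- The smaller one of the heights of the two boundaries of robot `i`, which is the height of the
boundary it is oriented to. It counts the meetings of robot `i`, up to a constant. -/
noncomputable def level (k : ℕ) (i : Fin n) : ℤ :=
  if x.o k i = 1 then x.height k i else x.height k i - 1

theorem level_of_forward {k : ℕ} {i : Fin n} (h : x.o k i = 1) :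
    x.level k i = x.height k i := if_pos h

theorem level_of_backward {k : ℕ} {i : Fin n} (h : x.o k i = -1) :
    x.level k i = x.height k i - 1 := if_neg (by rw [h]; decide)

theorem level_of_facing {k : ℕ} {i : Fin n} (h : x.o k i = 1) (h' : x.o k (i + 1) = -1) :
    x.level k (i + 1) = x.level k i := by
  rw [x.level_of_forward h, x.level_of_backward h', x.height_add_one k i, h']
  push_cast
  ring

theorem level_of_both_forward {k : ℕ} {i : Fin n} (h : x.o k i = 1) (h' : x.o k (i + 1) = 1) :
    x.level k (i + 1) = x.level k i - 1 := by
  rw [x.level_of_forward h, x.level_of_forward h', x.height_add_one k i, h']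
  push_cast
  ring

theorem level_of_both_backward {k : ℕ} {i : Fin n} (h : x.o k i = -1) (h' : x.o k (i + 1) = -1) :
    x.level k i = x.level k (i + 1) - 1 := by
  rw [x.level_of_backward h, x.level_of_backward h', x.height_add_one k i, h']
  push_cast
  ring

theorem level_after_meets {k : ℕ} {i : Fin n} (h : x.meets k i) :
    x.level (k + 1) i = x.level k i + 1 ∧ x.level (k + 1) (i + 1) = x.level k (i + 1) + 1 := by
  obtain ⟨h1, h2, -⟩ := x.of_meets h
  obtain ⟨h3, h4, -⟩ := x.after_meets h
  rw [x.level_of_forward h1, x.level_of_backward h2, x.level_of_backward h3,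
    x.level_of_forward h4, x.height_succ_of_meets h,
    x.height_succ_of_not_meets (x.not_meets_add_one h)]
  constructor <;> ring

theorem level_of_not_meets {k : ℕ} {i : Fin n} (h : ¬ x.meets k i) (h' : ¬ x.meets k (i - 1)) :
    x.level (k + 1) i = x.level k i := by
  rw [level, level, (x.of_not_meets h h').1, x.height_succ_of_not_meets h]

/-- Robot `i` takes part in a meeting, with its right or its left neighbour. -/
def Engaged (k : ℕ) (i : Fin n) : Prop := x.meets k i ∨ x.meets k (i - 1)

theorem Engaged.spec {x : Relay n P} {k : ℕ} {i : Fin n} (h : x.Engaged k i) :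
    x.level (k + 1) i = x.level k i + 1 ∧ x.τ k i ≤ x.time (k + 1) - x.time k ∧
      x.τ (k + 1) i = P := by
  rcases h with h | h
  · exact ⟨(x.level_after_meets h).1, (x.of_meets h).2.2.1, (x.after_meets h).2.2.1⟩
  · have h1 := (x.level_after_meets h).2
    have h2 := (x.of_meets h).2.2.2
    have h3 := (x.after_meets h).2.2.2
    rw [sub_add_cancel] at h1 h2 h3
    exact ⟨h1, h2, h3⟩

theorem of_not_engaged {k : ℕ} {i : Fin n} (h : ¬ x.Engaged k i) :
    x.level (k + 1) i = x.level k i ∧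
      x.τ (k + 1) i = max (x.τ k i - (x.time (k + 1) - x.time k)) 0 := by
  rw [Engaged, not_or] at h
  exact ⟨x.level_of_not_meets h.1 h.2, (x.of_not_meets h.1 h.2).2⟩

theorem level_mono (i : Fin n) : Monotone fun k => x.level k i := by
  refine monotone_nat_of_le_succ fun k => ?_
  by_cases h : x.Engaged k i
  · linarith [h.spec.1]
  · exact (x.of_not_engaged h).1.ge

theorem even_height_sub (k : ℕ) (i : Fin n) : Even (x.height k i - x.height 0 i) := by
  induction k with
  | zero => simp
  | succ k ih =>
    by_cases h : x.meets k i
    · rw [x.height_succ_of_meets h, add_sub_right_comm]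
      exact ih.add even_two
    · rwa [x.height_succ_of_not_meets h]

theorem o_eq_one_iff (k : ℕ) (i : Fin n) :
    x.o k i = 1 ↔ Even (x.level k i - x.height 0 i) := by
  have h := x.even_height_sub k i
  rcases Int.units_eq_one_or (x.o k i) with ho | ho
  · simp [ho, x.level_of_forward ho, h]
  · rw [x.level_of_backward ho, ho, sub_right_comm]
    simp only [show ¬ ((-1 : ℤˣ) = 1) by decide, false_iff, Int.not_even_iff_odd]
    exact h.sub_odd odd_one

/-- The time at which robot `i` is due at the boundary it is oriented to if it is moving, relative
to the periodic schedule `P * level`. Meetings do not change it; it grows while robot `i` waits. -/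
noncomputable def delay (k : ℕ) (i : Fin n) : ℝ := x.time k + x.τ k i - P * x.level k i

/-- Only the waiting between two steps changes the delay, whether or not a meeting follows. -/
theorem delay_succ (k : ℕ) (i : Fin n) :
    x.delay (k + 1) i =
      x.time (k + 1) + max (x.τ k i - (x.time (k + 1) - x.time k)) 0 - P * x.level k i := by
  by_cases h : x.Engaged k i
  · obtain ⟨h1, h2, h3⟩ := h.spec
    rw [delay, h1, h3, max_eq_right (by linarith)]
    push_cast
    ring
  · obtain ⟨h1, h2⟩ := x.of_not_engaged h
    rw [delay, h1, h2]

theorem delay_mono (i : Fin n) : Monotone fun k => x.delay k i := by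
  refine monotone_nat_of_le_succ fun k => ?_
  rw [delay_succ, delay]
  linarith [le_max_left (x.τ k i - (x.time (k + 1) - x.time k)) 0]

/-- The largest delay does not grow: a waiting robot has a neighbour that is due later, namely one
that is still on its way to their boundary, or one that turns its back and is a level behind. -/
theorem delay_le_succ_of_le {M : ℝ} {k : ℕ} (h : ∀ i, x.delay k i ≤ M) (i : Fin n) :
    x.delay (k + 1) i ≤ M := by
  -- `a` has the largest delay after the step
  obtain ⟨a, ha⟩ := Finite.exists_max fun i => x.delay (k + 1) i
  refine (ha i).trans ?_
  by_contra! hlt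
  have hP := x.period_pos
  have hexp : ∀ j, x.delay (k + 1) j = x.delay k j ∨ (x.τ k j < x.time (k + 1) - x.time k ∧
      x.delay (k + 1) j = x.time (k + 1) - P * x.level k j) := by
    intro j
    rw [delay_succ]
    rcases le_or_gt (x.time (k + 1) - x.time k) (x.τ k j) with h' | h'
    · left
      rw [max_eq_left (by linarith), delay]
      ring
    · exact Or.inr ⟨h', by rw [max_eq_right (by linarith), add_zero]⟩
  have hge : ∀ j, x.time (k + 1) - P * x.level k j ≤ x.delay (k + 1) j := by
    intro j
    rw [delay_succ]
    linarith [le_max_right (x.τ k j - (x.time (k + 1) - x.time k)) 0]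
  have hlate : ∀ j, M < x.delay (k + 1) j → x.τ k j < x.time (k + 1) - x.time k ∧
      x.delay (k + 1) j = x.time (k + 1) - P * x.level k j := by
    intro j hj
    exact (hexp j).resolve_left fun h' => absurd (h j) (by linarith)
  obtain ⟨hτ, hSa⟩ := hlate a hlt
  -- two robots that face each other cannot both be waiting
  have hfacing : ∀ j, x.o k j = 1 → x.o k (j + 1) = -1 → x.τ k j < x.time (k + 1) - x.time k →
      ¬ x.τ k (j + 1) < x.time (k + 1) - x.time k := by
    intro j h1 h2 h3 h4
    exact x.no_meeting k (max (x.τ k j) (x.τ k (j + 1))) j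
      (le_max_of_le_left (x.timer_nonneg k j)) (max_lt h3 h4) h1 h2 (le_max_left _ _)
      (le_max_right _ _)
  rcases Int.units_eq_one_or (x.o k a) with ho | ho
  · have h1 := ha (a + 1)
    have h2 := hge (a + 1)
    rcases Int.units_eq_one_or (x.o k (a + 1)) with ho' | ho'
    · rw [x.level_of_both_forward ho ho'] at h2
      push_cast at h2
      linarith
    · rw [x.level_of_facing ho ho'] at h2
      exact hfacing a ho ho' hτ (hlate _ (by linarith)).1
  · obtain ⟨b, rfl⟩ : ∃ b, a = b + 1 := ⟨a - 1, by simp⟩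
    have h1 := ha b
    have h2 := hge b
    rcases Int.units_eq_one_or (x.o k b) with ho' | ho'
    · rw [← x.level_of_facing ho' ho] at h2
      exact hfacing b ho' ho (hlate _ (by linarith)).1 hτ
    · rw [x.level_of_both_backward ho' ho] at h2
      push_cast at h2
      linarith

theorem delay_le_of_le {M : ℝ} {K : ℕ} (h : ∀ i, x.delay K i ≤ M) {k : ℕ} (hk : K ≤ k)
    (i : Fin n) : x.delay k i ≤ M := by
  induction k, hk using Nat.le_induction generalizing i with
  | base => exact h i
  | succ k _ ih => exact x.delay_le_succ_of_le ih i

/-- Robots that meet have equal delays afterwards, so a maximal delay spreads to the neighbours. -/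
theorem delay_eq_of_meets {k : ℕ} {i : Fin n} (h : x.meets k i) :
    x.delay (k + 1) (i + 1) = x.delay (k + 1) i := by
  obtain ⟨h1, h2, h3, h4⟩ := x.of_meets h
  rw [delay_succ, delay_succ, max_eq_right (by linarith), max_eq_right (by linarith),
    x.level_of_facing h1 h2]

/-- A robot with constant delay has a level that grows with time, hence so do the heights of both its
boundaries, and each of these grows only by meetings there. -/
theorem exists_meets {M : ℝ} {K : ℕ} {i : Fin n} (h : ∀ k ≥ K, x.delay k i = M) :
    ∃ k ≥ K, x.meets k i := by
  by_contra! hno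
  have hheight : ∀ k ≥ K, x.height k i = x.height K i := by
    intro k hk
    induction k, hk using Nat.le_induction with
    | base => rfl
    | succ k hk ih => rw [x.height_succ_of_not_meets (hno k hk), ih]
  obtain ⟨k, hk, hk'⟩ := ((x.time_unbounded.eventually_gt_atTop (M + P * x.height K i)).and
    (Filter.eventually_ge_atTop K)).exists
  have h1 := h k hk'
  have h2 : x.level k i ≤ x.height K i := by
    rw [← hheight k hk', level]
    split_ifs <;> linarith
  have h3 : P * x.level k i ≤ P * x.height K i :=
    mul_le_mul_of_nonneg_left (by exact_mod_cast h2) x.period_pos.le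
  rw [delay] at h1
  linarith [x.timer_nonneg k i]

theorem timer_le_period {K : ℕ} {i : Fin n} (h : x.τ K i ≤ P) {k : ℕ} (hk : K ≤ k) :
    x.τ k i ≤ P := by
  induction k, hk using Nat.le_induction with
  | base => exact h
  | succ k _ ih =>
    by_cases h' : x.Engaged k i
    · exact h'.spec.2.2.le
    · rw [(x.of_not_engaged h').2]
      have : x.time k ≤ x.time (k + 1) := x.time_mono k.le_succ
      exact max_le (by linarith) x.period_pos.le

/-- From step `K` on robot `i` has the constant delay `M`, which means that it never waits, and its
timer has been set by a meeting. -/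
def Settled (M : ℝ) (K : ℕ) (i : Fin n) : Prop := ∀ k ≥ K, x.delay k i = M ∧ x.τ k i ≤ P

/-- All robots attain the largest initial delay in the end: it is passed on from robot to robot. -/
theorem exists_settled : ∃ M K, ∀ i, x.Settled M K i := by
  obtain ⟨a, ha⟩ := Finite.exists_max fun i => x.delay 0 i
  set M := x.delay 0 a
  have hle : ∀ k i, x.delay k i ≤ M := fun k i => x.delay_le_of_le ha k.zero_le i
  have hkeep : ∀ K i, x.delay K i = M → ∀ k ≥ K, x.delay k i = M :=
    fun K i h k hk => (hle k i).antisymm (h ▸ x.delay_mono i hk)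
  have hex : ∀ i, ∃ K, x.delay K i = M :=
    Fin.forall_of_imp_add_one ⟨0, rfl⟩ fun i ⟨K, hK⟩ => by
      obtain ⟨k, hk, hm⟩ := x.exists_meets (hkeep K i hK)
      exact ⟨k + 1, (x.delay_eq_of_meets hm).trans (hkeep K i hK _ (by omega))⟩
  have hset : ∀ i, ∃ K, x.Settled M K i := by
    intro i
    obtain ⟨K, hK⟩ := hex i
    obtain ⟨k, hk, hm⟩ := x.exists_meets (hkeep K i hK)
    exact ⟨k + 1, fun l hl => ⟨hkeep K i hK l (by omega),
      x.timer_le_period (x.after_meets hm).2.2.1.le hl⟩⟩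
  choose K hK using hset
  refine ⟨M, Finset.univ.sup K, fun i k hk => hK i k ?_⟩
  exact (Finset.le_sup (Finset.mem_univ i)).trans hk

end Relay

/-! ### Relays of timers: the periodic schedule -/

namespace Relay

variable {n : ℕ} [NeZero n] {P : ℝ} (x : Relay n P)

/-- Robots `i` and `i + 1` meet at time `t`. -/
def MeetsAt (i : Fin n) (t : ℝ) : Prop := ∃ k, x.time (k + 1) = t ∧ x.meets k i

/-- At time `t` robot `i` has orientation `ε` and timer `θ`; at the time of a meeting this holds for
the values before and after it. -/
def StatusAt (i : Fin n) (t : ℝ) (ε : ℤˣ) (θ : ℝ) : Prop :=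
  ∃ k, x.time k ≤ t ∧ t ≤ x.time (k + 1) ∧ x.o k i = ε ∧ max (x.τ k i - (t - x.time k)) 0 = θ

/-- The last step before time `t`. -/
theorem exists_index_before {K : ℕ} {t : ℝ} (h : x.time K < t) :
    ∃ k ≥ K, x.time k < t ∧ t ≤ x.time (k + 1) := by
  classical
  have hex : ∃ k, t ≤ x.time k := (x.time_unbounded.eventually_ge_atTop t).exists
  have hlt : ∀ {l}, l < Nat.find hex → x.time l < t := fun hl => not_le.1 (Nat.find_min hex hl)
  have hK : K < Nat.find hex := by
    by_contra! hle
    exact absurd (Nat.find_spec hex) (not_le.2 ((x.time_mono hle).trans_lt h))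
  refine ⟨Nat.find hex - 1, by omega, hlt (by omega), ?_⟩
  rw [Nat.sub_add_cancel (by omega)]
  exact Nat.find_spec hex

/-- The last step up to time `t`. -/
theorem exists_index_after {K : ℕ} {t : ℝ} (h : x.time K ≤ t) :
    ∃ k ≥ K, x.time k ≤ t ∧ t < x.time (k + 1) := by
  classical
  have hex : ∃ k, t < x.time k := (x.time_unbounded.eventually_gt_atTop t).exists
  have hle : ∀ {l}, l < Nat.find hex → x.time l ≤ t := fun hl => not_lt.1 (Nat.find_min hex hl)
  have hK : K < Nat.find hex := by
    by_contra! hle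
    exact absurd (Nat.find_spec hex) (not_lt.2 ((x.time_mono hle).trans h))
  refine ⟨Nat.find hex - 1, by omega, hle (by omega), ?_⟩
  rw [Nat.sub_add_cancel (by omega)]
  exact Nat.find_spec hex

variable {x} {M : ℝ} {K : ℕ}

/-- A settled robot is due at the times `M + P * c`, with an integer `c`. -/
theorem Settled.due {i : Fin n} (h : x.Settled M K i) {k : ℕ} (hk : K ≤ k) :
    x.time k + x.τ k i = M + P * x.level k i := by
  have := (h k hk).1
  rw [delay] at this
  linarith

/-- A settled robot does not wait. -/
theorem Settled.le_timer {i : Fin n} (h : x.Settled M K i) {k : ℕ} (hk : K ≤ k) :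
    x.time (k + 1) - x.time k ≤ x.τ k i := by
  have h1 := (h (k + 1) (by omega)).1
  have h2 := h.due hk
  rw [delay_succ] at h1
  linarith [le_max_right (x.τ k i - (x.time (k + 1) - x.time k)) 0]

theorem lt_of_mul_cast_lt {P : ℝ} (hP : 0 < P) {a b : ℤ} (h : P * a < P * b) : a < b := by
  have := lt_of_mul_lt_mul_left h hP.le
  exact_mod_cast this

/-- The round is determined by a moment, and by the timer up to less than a period. -/
theorem eq_of_due_eq (hP : 0 < P) {a b : ℤ} {θ θ' : ℝ} (h : P * a - θ = P * b - θ')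
    (hθ : |θ - θ'| < P) : a = b := by
  rw [abs_lt] at hθ
  have h1 : a < b + 1 := lt_of_mul_cast_lt hP (by push_cast; linarith)
  have h2 : b < a + 1 := lt_of_mul_cast_lt hP (by push_cast; linarith)
  omega

theorem Settled.time_eq_of_engaged {i : Fin n} (h : x.Settled M K i) {k : ℕ} (hk : K ≤ k)
    (hm : x.Engaged k i) : x.time (k + 1) = M + P * x.level k i := by
  linarith [h.due hk, h.le_timer hk, hm.spec.2.1]

variable (x) in
/-- The orientation that robot `i` has at level `c`; it alternates. -/
noncomputable def orientationAt (i : Fin n) (c : ℤ) : ℤˣ :=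
  if Even (c - x.height 0 i) then 1 else -1

theorem o_eq_orientationAt (k : ℕ) (i : Fin n) :
    x.o k i = x.orientationAt i (x.level k i) := by
  have h := x.o_eq_one_iff k i
  rw [orientationAt]
  split_ifs with h'
  · exact h.2 h'
  · exact (Int.units_eq_one_or _).resolve_left fun h1 => h' (h.1 h1)

theorem orientationAt_add_one (i : Fin n) (c : ℤ) :
    x.orientationAt i (c + 1) = -x.orientationAt i c := by
  simp only [orientationAt, add_sub_right_comm, Int.even_add_one]
  split_ifs <;> simp_all

theorem Settled.statusAt_iff {i : Fin n} (h : x.Settled M K i) {t : ℝ} (ht : x.time K < t)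
    (ε : ℤˣ) (θ : ℝ) : x.StatusAt i t ε θ ↔
      0 ≤ θ ∧ θ ≤ P ∧ ∃ c : ℤ, ε = x.orientationAt i c ∧ t = M + P * c - θ := by
  have hP := x.period_pos
  have hle : ∀ k, t ≤ x.time (k + 1) → K ≤ k := by
    intro k hk
    by_contra! hlt
    exact absurd (x.time_mono (show k + 1 ≤ K from hlt)) (by linarith)
  constructor
  · rintro ⟨k, h1, h2, rfl, hθ⟩
    have hk := hle k h2
    have h3 := h.le_timer hk
    rw [max_eq_left (by linarith)] at hθ
    refine ⟨by linarith, by linarith [(h k hk).2], x.level k i, o_eq_orientationAt k i, ?_⟩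
    linarith [h.due hk]
  · rintro ⟨h0, hθP, c, rfl, hc⟩
    have key : ∃ k ≥ K, x.time k ≤ t ∧ t ≤ x.time (k + 1) ∧
        |x.τ k i - (t - x.time k) - θ| < P := by
      -- a timer at `P` is found right after the events at time `t`, any other one right before
      rcases hθP.lt_or_eq with hlt | rfl
      · obtain ⟨k, hk, h1, h2⟩ := x.exists_index_before ht
        refine ⟨k, hk, h1.le, h2, ?_⟩
        have h3 := (h k hk).2
        have h4 := h.le_timer hk
        rw [abs_lt]
        constructor <;> linarith
      · obtain ⟨k, hk, h1, h2⟩ := x.exists_index_after ht.le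
        refine ⟨k, hk, h1, h2.le, ?_⟩
        have h3 := (h k hk).2
        have h4 := h.le_timer hk
        rw [abs_lt]
        constructor <;> linarith
    obtain ⟨k, hk, h1, h2, h3⟩ := key
    have hdue := h.due hk
    have hlev : x.level k i = c := eq_of_due_eq hP (by linarith) h3
    refine ⟨k, h1, h2, hlev ▸ o_eq_orientationAt k i, ?_⟩
    rw [hlev] at hdue
    rw [max_eq_left (by linarith [h.le_timer hk])]
    linarith

theorem exists_engaged_of_level_ne {i : Fin n} {k l : ℕ} (hkl : k ≤ l)
    (hne : x.level l i ≠ x.level k i) : ∃ j ≥ k, j < l ∧ x.Engaged j i := by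
  by_contra! h
  refine hne ?_
  induction l, hkl using Nat.le_induction with
  | base => rfl
  | succ l hl ih =>
    have h1 : x.level l i = x.level k i := by
      by_contra hne'
      exact hne' (ih hne' fun j hj hjl => h j hj (by omega))
    rw [(x.of_not_engaged (h l hl l.lt_succ_self)).1, h1]

theorem Settled.exists_engaged {i : Fin n} (h : x.Settled M K i) {t : ℝ} (ht : x.time K < t)
    {c : ℤ} (hc : t = M + P * c) : ∃ j, x.time (j + 1) = t ∧ x.Engaged j i := by
  have hP := x.period_pos
  obtain ⟨k, hk, h1, h2⟩ := x.exists_index_before ht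
  obtain ⟨l, hl, h3, h4⟩ := x.exists_index_after ht.le
  have hkl : k ≤ l := by
    by_contra! hlt
    exact absurd (x.time_mono (show l + 1 ≤ k from hlt)) (by linarith)
  -- the level is `c` before the events at time `t`, and `c + 1` after them
  have hne : x.level l i ≠ x.level k i := by
    intro heq
    have h5 := h.due hk
    have h6 := h.due hl
    have h7 : x.level k i < c + 1 := lt_of_mul_cast_lt hP (by push_cast; linarith [(h k hk).2])
    have h8 : c < x.level l i := lt_of_mul_cast_lt hP (by linarith [h.le_timer hl])
    omega
  obtain ⟨j, hj, hjl, hm⟩ := exists_engaged_of_level_ne hkl hne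
  refine ⟨j, le_antisymm ((x.time_mono (show j + 1 ≤ l from hjl)).trans h3) ?_, hm⟩
  exact h2.trans (x.time_mono (show k + 1 ≤ j + 1 by omega))

theorem Settled.eq_of_engaged {i : Fin n} (h : x.Settled M K i) {j l : ℕ} (hj : K ≤ j)
    (hl : K ≤ l) (hjm : x.Engaged j i) (hlm : x.Engaged l i)
    (ht : x.time (j + 1) = x.time (l + 1)) : j = l := by
  have hP := x.period_pos
  have hlt : ∀ {j l : ℕ}, K ≤ j → K ≤ l → x.Engaged j i → x.Engaged l i →
      x.time (j + 1) = x.time (l + 1) → ¬ j < l := by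
    intro j l hj hl hjm hlm ht hjl
    have h1 := h.time_eq_of_engaged hj hjm
    have h2 := h.time_eq_of_engaged hl hlm
    have h3 := x.level_mono i (show j + 1 ≤ l from hjl)
    simp only [hjm.spec.1] at h3
    have h4 : x.level l i < x.level j i + 1 := lt_of_mul_cast_lt hP (by push_cast; linarith)
    omega
  rcases lt_trichotomy j l with h' | h' | h'
  · exact absurd h' (hlt hj hl hjm hlm ht)
  · exact h'
  · exact absurd h' (hlt hl hj hlm hjm ht.symm)

/-- After some time `T` the relay runs in rounds of duration `P`: every robot meets one of its
neighbours at the beginning of each round, alternately its left and its right one, and its timer is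
the remaining time of the round. -/
theorem exists_schedule (x : Relay n P) : ∃ T > x.time 0,
    (∀ i, ∃ σ : ℕ → ℤˣ, (∀ m, σ (m + 1) = -σ m) ∧ ∀ t > T, ∀ ε θ, x.StatusAt i t ε θ ↔
      0 ≤ θ ∧ θ ≤ P ∧ ∃ m : ℕ, ε = σ m ∧ t = T + (m + 1) * P - θ) ∧
    (∀ m : ℕ, ∀ i, Xor (x.MeetsAt i (T + m * P)) (x.MeetsAt (i - 1) (T + m * P))) ∧
    (∀ t ≥ T, ∀ i, x.MeetsAt i t → ∃ m : ℕ, t = T + m * P) := by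
  obtain ⟨M, K, hset⟩ := x.exists_settled
  have hP := x.period_pos
  obtain ⟨q, hq⟩ : ∃ q : ℤ, x.time K < M + P * q := by
    obtain ⟨q, hq⟩ := exists_int_gt ((x.time K - M) / P)
    refine ⟨q, ?_⟩
    rw [div_lt_iff₀ hP] at hq
    linarith
  have hle : ∀ {k t}, M + P * q ≤ t → x.time (k + 1) = t → K ≤ k := by
    intro k t ht hk
    by_contra! hlt
    exact absurd (x.time_mono (show k + 1 ≤ K from hlt)) (by linarith)
  refine ⟨M + P * q, (x.time_mono K.zero_le).trans_lt hq, ?_, ?_, ?_⟩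
  · intro i
    refine ⟨fun m => x.orientationAt i (q + 1 + m), fun m => ?_, fun t ht ε θ => ?_⟩
    · rw [← orientationAt_add_one]
      push_cast
      ring_nf
    · rw [(hset i).statusAt_iff (hq.trans ht)]
      refine and_congr_right fun h0 => and_congr_right fun h1 => ?_
      constructor
      · rintro ⟨c, rfl, hc⟩
        have hqc : q < c := lt_of_mul_cast_lt hP (by linarith)
        obtain ⟨m, hm⟩ := Int.le.dest (show q + 1 ≤ c from hqc)
        refine ⟨m, by simp only [hm], ?_⟩
        rw [hc, ← hm]
        push_cast
        ring
      · rintro ⟨m, rfl, hm⟩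
        refine ⟨_, rfl, ?_⟩
        rw [hm]
        push_cast
        ring
  · intro m i
    have hm : M + P * q ≤ M + P * q + m * P := by
      linarith [mul_nonneg (Nat.cast_nonneg (α := ℝ) m) hP.le]
    obtain ⟨j, hj, hje⟩ := (hset i).exists_engaged (hq.trans_le hm) (c := q + m)
      (by push_cast; ring)
    have hnot : ¬ (x.MeetsAt i (M + P * q + m * P) ∧ x.MeetsAt (i - 1) (M + P * q + m * P)) := by
      rintro ⟨⟨k, hk, hkm⟩, l, hl, hlm⟩
      obtain rfl := (hset i).eq_of_engaged (hle hm hk) (hle hm hl) (Or.inl hkm) (Or.inr hlm)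
        (hk.trans hl.symm)
      exact x.not_meets_add_one hlm (by simpa using hkm)
    rcases hje with h | h
    · exact Or.inl ⟨⟨j, hj, h⟩, fun h' => hnot ⟨⟨j, hj, h⟩, h'⟩⟩
    · exact Or.inr ⟨⟨j, hj, h⟩, fun h' => hnot ⟨h', ⟨j, hj, h⟩⟩⟩
  · rintro t ht i ⟨k, hk, hkm⟩
    have h1 := (hset i).time_eq_of_engaged (hle ht hk) (Or.inl hkm)
    have h2 : q < x.level k i + 1 := lt_of_mul_cast_lt hP (by push_cast; linarith)
    obtain ⟨m, hm⟩ := Int.le.dest (show q ≤ x.level k i by omega)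
    refine ⟨m, ?_⟩
    rw [← hk, h1, ← hm]
    push_cast
    ring

end Relay

/-! ### The relay of an execution, and recurrence in alternate rounds -/

namespace Team.Execution

variable {n : ℕ} [NeZero n] {R : Team n} (x : R.Execution)

theorem duration_nonneg (k : ℕ) : 0 ≤ x.time (k + 1) - x.time k :=
  sub_nonneg.2 (x.time_mono k.le_succ)

theorem consistent (h1 : (1 : Fin n) ≠ 0) (h0 : R.Consistent (x.state 0)) (k : ℕ) :
    R.Consistent (x.state k) := by
  induction k with
  | zero => exact h0
  | succ k ih =>
    rw [x.state_succ]
    exact (ih.flow (x.duration_nonneg k) (x.not_enabled k)).afterEvent h1 (x.enabled k)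

theorem balanced (h0 : (x.state 0).Balanced) (k : ℕ) : (x.state k).Balanced := by
  induction k with
  | zero => exact h0
  | succ k ih =>
    rw [x.state_succ]
    exact balanced_afterEvent (x.enabled k) ih

theorem atGoal {k₀ : ℕ} (h0 : R.AtGoal (x.state k₀)) {k : ℕ} (hk : k₀ ≤ k) :
    R.AtGoal (x.state k) := by
  induction k, hk using Nat.le_induction with
  | base => exact h0
  | succ k _ ih =>
    rw [x.state_succ]
    exact AtGoal.afterEvent (s := R.flow (x.state k) _) ih (x.enabled k)

theorem timer_flow {k : ℕ} (hc : R.Consistent (x.state k)) (hg : R.AtGoal (x.state k)) {δ : ℝ}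
    (h0 : 0 ≤ δ) (hδ : δ ≤ x.time (k + 1) - x.time k) (i : Fin n) :
    R.timer (R.flow (x.state k) δ) i = max (R.timer (x.state k) i - δ) 0 :=
  timer_flow_eq_max hc hg h0 (fun δ' h h' => x.not_enabled k δ' h (h'.trans_le hδ)) i

theorem of_meeting {k : ℕ} {i : Fin n} (h : x.event k = .meeting i) :
    R.AtRight (R.flow (x.state k) (x.time (k + 1) - x.time k)) i ∧
      R.AtLeft (R.flow (x.state k) (x.time (k + 1) - x.time k)) (i + 1) := by
  have := x.enabled k
  rwa [h] at this

theorem timer_of_not_meeting {k : ℕ} {i : Fin n} (hg : R.AtGoal (x.state k))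
    (h : x.event k ≠ .meeting i) (h' : x.event k ≠ .meeting (i - 1)) :
    (x.state (k + 1)).o i = (x.state k).o i ∧ R.timer (x.state (k + 1)) i =
      R.timer (R.flow (x.state k) (x.time (k + 1) - x.time k)) i := by
  have he := x.enabled k
  rw [x.state_succ]
  rcases hev : x.event k with j | j | j | j | j | j
  · rw [hev] at he
    exact absurd he.1 (hg.y_ne_none j)
  · rw [hev] at he
    exact absurd he.1 (hg.y_ne_none j)
  · rw [hev] at he
    exact absurd he.1 (hg.y_ne_none j)
  · exact ⟨rfl, rfl⟩
  · exact ⟨rfl, rfl⟩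
  · have hij : i ≠ j := by
      rintro rfl
      exact h hev
    have hij' : i ≠ j + 1 := by
      rintro rfl
      exact h' (by simpa using hev)
    have ho : (R.afterEvent (R.flow (x.state k) (x.time (k + 1) - x.time k)) (.meeting j)).o i =
        (x.state k).o i := by
      simp [afterEvent, hij, hij', flow]
    exact ⟨ho, timer_congr rfl ho⟩

/-- The relay of timers that an execution follows from step `k₀` on, when all boundaries are at
their goal positions. -/
noncomputable def relay (h1 : (1 : Fin n) ≠ 0) (hc : ∀ k, R.Consistent (x.state k)) (k₀ : ℕ)
    (hg : ∀ k ≥ k₀, R.AtGoal (x.state k)) (hb : (x.state k₀).Balanced) : Relay n R.tStar where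
  time k := x.time (k₀ + k)
  o k := (x.state (k₀ + k)).o
  τ k := R.timer (x.state (k₀ + k))
  meets k i := x.event (k₀ + k) = .meeting i
  period_pos := R.tStar_pos
  time_mono := fun _ _ h => x.time_mono (Nat.add_le_add_left h k₀)
  time_unbounded := x.time_unbounded.comp (Filter.tendsto_atTop_mono (fun k => Nat.le_add_left k k₀)
    Filter.tendsto_id)
  balanced := RobotState.balanced_iff.1 hb
  timer_nonneg k i := (hc _).timer_nonneg (hg _ (Nat.le_add_right _ _)) i
  no_meeting k δ i h0 hδ ho ho' hτ hτ' := by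
    have hgk := hg _ (Nat.le_add_right k₀ k)
    have hgf : R.AtGoal (R.flow (x.state (k₀ + k)) δ) := hgk
    have htimer := x.timer_flow (hc _) hgk h0 hδ.le
    refine x.not_enabled (k₀ + k) δ h0 hδ (.meeting i) ⟨hgf.atRight_iff.2 ⟨ho, ?_⟩,
      hgf.atLeft_iff.2 ⟨ho', ?_⟩⟩
    · rw [htimer, max_eq_right (by linarith)]
    · rw [htimer, max_eq_right (by linarith)]
  of_meets {k i} h := by
    have hgk := hg _ (Nat.le_add_right k₀ k)
    have hgf : R.AtGoal (R.flow (x.state (k₀ + k)) (x.time (k₀ + k + 1) - x.time (k₀ + k))) := hgk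
    have htimer := x.timer_flow (hc _) hgk (x.duration_nonneg (k₀ + k)) le_rfl
    obtain ⟨hr, hl⟩ := x.of_meeting h
    obtain ⟨ho, hr⟩ := hgf.atRight_iff.1 hr
    obtain ⟨ho', hl⟩ := hgf.atLeft_iff.1 hl
    rw [htimer, max_eq_right_iff] at hr hl
    exact ⟨ho, ho', sub_nonpos.1 hr, sub_nonpos.1 hl⟩
  after_meets {k i} h := by
    have hgk := hg _ (Nat.le_add_right k₀ k)
    have hgf : R.AtGoal (R.flow (x.state (k₀ + k)) (x.time (k₀ + k + 1) - x.time (k₀ + k))) := hgk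
    obtain ⟨hr, hl⟩ := x.of_meeting h
    have hii : i ≠ i + 1 := fun h => h1 (by simpa using h.symm)
    rw [← add_assoc, x.state_succ, h]
    exact ⟨by simp [afterEvent, hii], by simp [afterEvent], timer_after_meeting_left h1 hgf hr,
      timer_after_meeting_right hgf hl⟩
  of_not_meets {k i} h h' := by
    have hgk := hg _ (Nat.le_add_right k₀ k)
    have htimer := x.timer_flow (hc _) hgk (x.duration_nonneg (k₀ + k)) le_rfl i
    have := x.timer_of_not_meeting hgk h h'
    exact ⟨this.1, this.2.trans htimer⟩

end Team.Execution

/-- An alternating sign takes a given value at the indices of one parity. -/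
theorem eq_iff_of_alternating {σ : ℕ → ℤˣ} (hσ : ∀ m, σ (m + 1) = -σ m) (ε : ℤˣ) :
    ∃ m₀ ≤ 1, ∀ m, ε = σ m ↔ ∃ l, m = m₀ + 2 * l := by
  have hpow : ∀ m, σ m = σ 0 * (-1) ^ m := by
    intro m
    induction m with
    | zero => simp
    | succ m ih => rw [hσ, ih, pow_succ]; simp
  have hcases : ∀ m, σ m = if m % 2 = 0 then σ 0 else -σ 0 := by
    intro m
    rw [hpow]
    split_ifs with h
    · rw [(Nat.even_iff.2 h).neg_one_pow, mul_one]
    · rw [(Nat.odd_iff.2 (by omega)).neg_one_pow]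
      simp
  have hne : -σ 0 ≠ σ 0 := by
    rcases Int.units_eq_one_or (σ 0) with h | h <;> rw [h] <;> decide
  by_cases h0 : ε = σ 0
  · refine ⟨0, zero_le_one, fun m => ?_⟩
    rw [hcases, h0]
    split_ifs with h
    · exact ⟨fun _ => ⟨m / 2, by omega⟩, fun _ => rfl⟩
    · refine ⟨fun h' => absurd h'.symm hne, ?_⟩
      rintro ⟨l, rfl⟩
      omega
  · refine ⟨1, le_rfl, fun m => ?_⟩
    have h1 : ε = -σ 0 := Int.units_ne_iff_eq_neg.1 h0
    rw [hcases, h1]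
    split_ifs with h
    · refine ⟨fun h' => absurd h' hne, ?_⟩
      rintro ⟨l, rfl⟩
      omega
    · exact ⟨fun _ => ⟨m / 2, by omega⟩, fun _ => rfl⟩

/-- A moment `T + (m + 1) * P - θ` in every other round recurs every `2 * P`. -/
theorem recursEvery_of_alternating {σ : ℕ → ℤˣ} (hσ : ∀ m, σ (m + 1) = -σ m) {ε : ℤˣ} {A : Set ℝ}
    {T P θ : ℝ} (h0 : 0 ≤ θ) (hθ : θ ≤ P) (hP : 0 < P)
    (hA : ∀ t > T, t ∈ A ↔ ∃ m : ℕ, ε = σ m ∧ t = T + (m + 1) * P - θ) :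
    RecursEvery A T (2 * P) := by
  obtain ⟨m₀, hm₀, hm⟩ := eq_iff_of_alternating hσ ε
  have hA' : ∀ t > T, t ∈ A ↔ ∃ l : ℕ, t = T + (m₀ + 1) * P - θ + l * (2 * P) := by
    intro t ht
    rw [hA t ht]
    constructor
    · rintro ⟨m, hε, rfl⟩
      obtain ⟨l, rfl⟩ := (hm m).1 hε
      refine ⟨l, ?_⟩
      push_cast
      ring
    · rintro ⟨l, rfl⟩
      refine ⟨m₀ + 2 * l, (hm _).2 ⟨l, rfl⟩, ?_⟩
      push_cast
      ring
  have h1 : (m₀ : ℝ) * P ≤ P := by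
    have : (m₀ : ℝ) ≤ 1 := by exact_mod_cast hm₀
    nlinarith
  have h2 : 0 ≤ (m₀ : ℝ) * P := by positivity
  rcases (show T ≤ T + (m₀ + 1) * P - θ by linarith).lt_or_eq with hlt | heq
  · exact ⟨_, ⟨hlt, by linarith⟩, hA'⟩
  -- the moment is the beginning of the round `0`, which is not after `T`
  · refine ⟨T + 2 * P, ⟨by linarith, le_rfl⟩, fun t ht => ?_⟩
    rw [hA' t ht, ← heq]
    constructor
    · rintro ⟨_ | l, rfl⟩
      · simp at ht
      · refine ⟨l, ?_⟩
        push_cast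
        ring
    · rintro ⟨l, rfl⟩
      refine ⟨l + 1, ?_⟩
      push_cast
      ring

/-- If `Z` consists of an interval of moments in every other round, with `b` the longest remaining
time of the round, then the moments that begin these intervals recur every `2 * P`. -/
theorem recursEvery_arrival {σ : ℕ → ℤˣ} (hσ : ∀ m, σ (m + 1) = -σ m) {ε : ℤˣ} {Z : Set ℝ}
    {T P a b : ℝ} (ha : 0 ≤ a) (hab : a ≤ b) (hb : b ≤ P) (hP : 0 < P)
    (hZ : ∀ t > T, t ∈ Z ↔ ∃ θ ∈ Set.Icc a b, ∃ m : ℕ, ε = σ m ∧ t = T + (m + 1) * P - θ) :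
    RecursEvery {t | t ∈ Z ∧ ∃ δ > 0, ∀ t' ∈ Set.Ioo (t - δ) t, t' ∉ Z} T (2 * P) := by
  refine recursEvery_of_alternating hσ (ε := ε) (ha.trans hab) hb hP fun t ht => ?_
  constructor
  · rintro ⟨htZ, δ, hδ, hno⟩
    obtain ⟨θ, ⟨haθ, hθb⟩, m, hε, hm⟩ := (hZ t ht).1 htZ
    rcases hθb.lt_or_eq with hlt | rfl
    · obtain ⟨η, hη, hη'⟩ : ∃ η, 0 < η ∧ η < min δ (min (b - θ) (t - T)) :=
        exists_between (lt_min hδ (lt_min (by linarith) (by linarith)))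
      rw [lt_min_iff, lt_min_iff] at hη'
      refine absurd ((hZ (t - η) (by linarith)).2
        ⟨θ + η, ⟨by linarith, by linarith⟩, m, hε, by linarith⟩)
        (hno _ ⟨by linarith, by linarith⟩)
    · exact ⟨m, hε, hm⟩
  · rintro ⟨m, hε, hm⟩
    refine ⟨(hZ t ht).2 ⟨b, ⟨hab, le_rfl⟩, m, hε, hm⟩, min P (t - T),
      lt_min hP (by linarith), ?_⟩
    rintro t' ⟨h1, h2⟩ ht'
    have h3 := min_le_left P (t - T)
    have h4 := min_le_right P (t - T)
    obtain ⟨θ, ⟨haθ, hθb⟩, m', hε', hm'⟩ := (hZ t' (by linarith)).1 ht'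
    -- `m` and `m'` have the same parity, but less than `2 * P` lies between the two moments
    obtain ⟨m₀, -, hm₀⟩ := eq_iff_of_alternating hσ ε
    obtain ⟨l, rfl⟩ := (hm₀ m).1 hε
    obtain ⟨l', rfl⟩ := (hm₀ m').1 hε'
    push_cast at hm hm'
    have h5 : (l' : ℝ) < l := by
      by_contra! hle
      have := mul_le_mul_of_nonneg_right hle hP.le
      linarith
    have h6 : (l : ℝ) < l' + 1 := by
      by_contra! hle
      have := mul_le_mul_of_nonneg_right hle hP.le
      linarith
    have h7 : l' < l := by exact_mod_cast h5
    have h8 : l < l' + 1 := by exact_mod_cast h6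
    omega

/-! ### Geometry of the regions, and the periodic regime -/

namespace Team

section

variable {n : ℕ} (R : Team n)

/-- The distance from `c` to the goal boundary that lies ahead of robot `i` when it has orientation
`ε`. -/
noncomputable def distAhead (i : Fin n) (ε : ℤˣ) (c : ℝ) : ℝ :=
  if ε = 1 then R.yStar i - c else c - R.leftStar i

/-- The distance of a robot from a point, in terms of its orientation and its timer. -/
theorem abs_p_sub {s : RobotState n} {i : Fin n} (c : ℝ) :
    |s.p i - c| = |R.distAhead i (s.o i) c - R.r i - R.v i * R.timer s i| := by
  rcases Int.units_eq_one_or (s.o i) with ho | ho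
  · rw [p_eq_of_forward (R := R) ho, ho, distAhead, if_pos rfl]
    congr 1
    ring
  · rw [p_eq_of_backward (R := R) ho, ho, distAhead, if_neg (by decide), ← abs_neg]
    congr 1
    ring

theorem distAhead_mem {i : Fin n} {c ρ : ℝ}
    (hc : c ∈ Set.Icc (R.leftStar i + ρ) (R.yStar i - ρ)) (ε : ℤˣ) :
    R.distAhead i ε c ∈ Set.Icc ρ (R.v i * R.tStar + 2 * R.r i - ρ) := by
  have h := R.yStar_eq i
  rw [dStar] at h
  rw [distAhead]
  split_ifs <;> constructor <;> linarith [hc.1, hc.2]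

end

variable {n : ℕ} [NeZero n] (R : Team n)

/-- The values of the timer of robot `i` for which a point at distance `d` from the boundary ahead
is in its communication zone form a closed interval. -/
theorem exists_timer_interval (i : Fin n) {d : ℝ}
    (hd : d ∈ Set.Icc 0 (R.v i * R.tStar + 2 * R.r i)) : ∃ a b, 0 ≤ a ∧ a ≤ b ∧ b ≤ R.tStar ∧
      ∀ θ, (0 ≤ θ ∧ θ ≤ R.tStar ∧ |d - R.r i - R.v i * θ| ≤ R.r i) ↔ θ ∈ Set.Icc a b := by
  have hv := R.v_pos i
  have hr := R.r_nonneg i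
  have ht := R.tStar_pos
  obtain ⟨hd0, hd1⟩ := hd
  refine ⟨max 0 ((d - 2 * R.r i) / R.v i), min R.tStar (d / R.v i), le_max_left _ _,
    max_le (le_min ht.le (div_nonneg hd0 hv.le)) (le_min ?_ ?_), min_le_left _ _, fun θ => ?_⟩
  · rw [div_le_iff₀ hv]
    linarith
  · exact div_le_div_of_nonneg_right (by linarith) hv.le
  · rw [Set.mem_Icc, max_le_iff, le_min_iff, div_le_iff₀ hv, le_div_iff₀ hv, abs_le]
    constructor
    · rintro ⟨h1, h2, h3, h4⟩
      exact ⟨⟨h1, by linarith⟩, h2, by linarith⟩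
    · rintro ⟨⟨h1, h2⟩, h3, h4⟩
      exact ⟨h1, h3, by linarith, by linarith⟩

theorem exists_mem_region {c : ℝ} (hc : c ∈ Set.Icc 0 R.L) :
    ∃ i, c ∈ Set.Icc (R.leftStar i) (R.yStar i) := by
  classical
  let F := Finset.univ.filter fun i => c ≤ R.yStar i
  have hF : ∀ i, c ≤ R.yStar i → i ∈ F := fun i hi =>
    Finset.mem_filter.2 ⟨Finset.mem_univ _, hi⟩
  have hne : F.Nonempty := ⟨-1, hF _ (by rw [R.yStar_last (neg_add_cancel 1)]; exact hc.2)⟩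
  have hmem := F.min'_mem hne
  refine ⟨F.min' hne, ?_, (Finset.mem_filter.1 hmem).2⟩
  by_cases h0 : F.min' hne = 0
  · rw [h0, leftStar_zero]
    exact hc.1
  · rw [leftStar_eq R h0]
    by_contra! hlt
    have hle := F.min'_le _ (hF _ hlt.le)
    rw [Fin.le_def, Fin.val_sub_one_of_ne_zero h0] at hle
    have : (F.min' hne).val ≠ 0 := fun h => h0 (Fin.ext (by simpa using h))
    omega

end Team

/-- The pairs that meet in a round are half of all pairs, as every robot belongs to one of them. -/
theorem two_mul_ncard_of_xor {n : ℕ} [NeZero n] {p : Fin n → Prop}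
    (h : ∀ i, Xor (p i) (p (i - 1))) : 2 * {i | p i}.ncard = n := by
  have hcompl : {i | p i}ᶜ = (fun i => i + 1) '' {i | p i} := by
    ext i
    simp only [Set.mem_compl_iff, Set.mem_ofPred_eq, Set.mem_image]
    constructor
    · intro hi
      rcases h i with h' | h'
      · exact absurd h'.1 hi
      · exact ⟨i - 1, h'.1, sub_add_cancel _ _⟩
    · rintro ⟨j, hj, rfl⟩ hj'
      have := h (j + 1)
      rw [add_sub_cancel_right] at this
      rcases this with h' | h'
      · exact h'.2 hj
      · exact h'.2 hj'
  have hcard := Set.ncard_add_ncard_compl {i | p i}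
  rw [hcompl, Set.ncard_image_of_injective _ (add_left_injective 1), Nat.card_eq_fintype_card,
    Fintype.card_fin] at hcard
  omega

namespace Team.Execution

variable {n : ℕ} [NeZero n] {R : Team n} (x : R.Execution)

/-- The times at which robot `i` is within distance `ρ` of `c`, in terms of the relay. The radius
`ρ = 0` gives the visits of `c`, and `ρ = r i` the presence of `c` in the communication zone. -/
theorem exists_stateAt_iff (h1 : (1 : Fin n) ≠ 0) (hc : ∀ k, R.Consistent (x.state k)) {k₀ : ℕ}
    (hg : ∀ k ≥ k₀, R.AtGoal (x.state k)) (hb : (x.state k₀).Balanced) {t : ℝ}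
    (ht : x.time k₀ < t) (i : Fin n) (ε : ℤˣ) (c ρ : ℝ) :
    (∃ s, x.StateAt t s ∧ |s.p i - c| ≤ ρ ∧ s.o i = ε) ↔
      ∃ θ, (x.relay h1 hc k₀ hg hb).StatusAt i t ε θ ∧
        |R.distAhead i ε c - R.r i - R.v i * θ| ≤ ρ := by
  have htimer : ∀ k ≥ k₀, x.time k ≤ t → t ≤ x.time (k + 1) →
      R.timer (R.flow (x.state k) (t - x.time k)) i =
        max (R.timer (x.state k) i - (t - x.time k)) 0 := fun k hk h h' =>
    x.timer_flow (hc k) (hg k hk) (by linarith) (by linarith) i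
  constructor
  · rintro ⟨s, ⟨k, hk, hk', rfl⟩, hp, rfl⟩
    obtain ⟨l, rfl⟩ : ∃ l, k = k₀ + l := by
      refine Nat.exists_eq_add_of_le ?_
      by_contra! hlt
      exact absurd (x.time_mono (show k + 1 ≤ k₀ from hlt)) (by linarith)
    rw [R.abs_p_sub] at hp
    exact ⟨_, ⟨l, hk, hk', rfl, (htimer _ (Nat.le_add_right _ _) hk hk').symm⟩, hp⟩
  · rintro ⟨θ, ⟨l, hk, hk', rfl, rfl⟩, hp⟩
    refine ⟨_, ⟨k₀ + l, hk, hk', rfl⟩, ?_, rfl⟩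
    rw [R.abs_p_sub, htimer _ (Nat.le_add_right _ _) hk hk']
    exact hp

end Team.Execution

theorem theorem2 {n : ℕ} [NeZero n] (R : Team n) (x : R.Execution)
    (hstart : R.Deployed (x.state 0) ∨ R.InRegions (x.state 0))
    (hbal : (x.state 0).Balanced)
    (k₀ : ℕ) (hcommon : R.CommonTraversingTimes (x.state k₀)) :
    -- from then on the boundaries, and hence the traversing times, stay at their goal values
    (∀ k ≥ k₀, ∀ i, (x.state k).left i = some (R.leftStar i) ∧
      (x.state k).y i = some (R.yStar i) ∧
      (R.yStar i - R.leftStar i - 2 * R.r i) / R.v i = R.tStar) ∧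
    ∃ T ≥ x.time k₀,
      -- all `n / 2` meetings, which involve all `n` robots, take place simultaneously, one
      -- round of duration `t⋆` after the other, and there are no other meetings
      (∀ m : ℕ, 2 * {i | x.MeetingAt i (T + m * R.tStar)}.ncard = n ∧
        ∀ i, Xor (x.MeetingAt i (T + m * R.tStar)) (x.MeetingAt (i - 1) (T + m * R.tStar))) ∧
      (∀ t ≥ T, ∀ i, x.MeetingAt i t → ∃ m : ℕ, t = T + m * R.tStar) ∧
      -- every robot returns to every point of its path, with the same orientation, every `2 t⋆`
      (∀ i, ∀ c ∈ Set.Icc (R.leftStar i + R.r i) (R.yStar i - R.r i), ∀ ε,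
        RecursEvery (x.positionTimes i c ε) T (2 * R.tStar)) ∧
      -- every point of the cycle is in the region of some robot, and the communication zone of
      -- that robot arrives there, with the same orientation, every `2 t⋆`
      (∀ c ∈ Set.Icc 0 R.L, ∃ i, c ∈ Set.Icc (R.leftStar i) (R.yStar i)) ∧
      (∀ i, ∀ c ∈ Set.Icc (R.leftStar i) (R.yStar i), ∀ ε,
        RecursEvery (x.zoneArrivalTimes i c ε) T (2 * R.tStar)) := by
  have hbal' := x.balanced hbal
  have h1 : (1 : Fin n) ≠ 0 := hbal.one_ne_zero
  have hc := x.consistent h1 (hstart.elim (fun h => h.consistent h1) fun h => h.consistent)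
  have hg : ∀ k ≥ k₀, R.AtGoal (x.state k) := fun k hk => x.atGoal hcommon.atGoal hk
  have hP := R.tStar_pos
  refine ⟨fun k hk i => ⟨(hg k hk i).1, (hg k hk i).2, ?_⟩, ?_⟩
  · rw [R.yStar_eq, Team.dStar, div_eq_iff (R.v_pos i).ne']
    ring
  obtain ⟨T, hT, hstatus, hmeet, hmeet'⟩ := (x.relay h1 hc k₀ hg (hbal' k₀)).exists_schedule
  change x.time k₀ < T at hT
  -- meetings from `T` on belong to events with index at least `k₀`
  have hmeets : ∀ t ≥ T, ∀ i,
      x.MeetingAt i t ↔ (x.relay h1 hc k₀ hg (hbal' k₀)).MeetsAt i t := by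
    intro t ht i
    constructor
    · rintro ⟨k, hk, he⟩
      obtain ⟨l, rfl⟩ : ∃ l, k = k₀ + l := by
        refine Nat.exists_eq_add_of_le ?_
        by_contra! hlt
        exact absurd (x.time_mono (show k + 1 ≤ k₀ from hlt)) (by linarith)
      exact ⟨l, hk, he⟩
    · rintro ⟨l, hl, he⟩
      exact ⟨k₀ + l, hl, he⟩
  have hround : ∀ m : ℕ, ∀ i,
      Xor (x.MeetingAt i (T + m * R.tStar)) (x.MeetingAt (i - 1) (T + m * R.tStar)) := by
    intro m i
    have hm : T + m * R.tStar ≥ T := le_add_of_nonneg_right (by positivity)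
    rw [hmeets _ hm, hmeets _ hm]
    exact hmeet m i
  refine ⟨T, hT.le, fun m => ⟨two_mul_ncard_of_xor (hround m), hround m⟩,
    fun t ht i h => hmeet' t ht i ((hmeets t ht i).1 h), ?_, fun c hc => R.exists_mem_region hc, ?_⟩
  · intro i c hci ε
    obtain ⟨σ, hσ, hσ'⟩ := hstatus i
    have hv := R.v_pos i
    obtain ⟨hd0, hd1⟩ := R.distAhead_mem hci ε
    set d := R.distAhead i ε c
    refine recursEvery_of_alternating hσ (ε := ε) (θ := (d - R.r i) / R.v i)
      (div_nonneg (by linarith) hv.le) ((div_le_iff₀ hv).2 (by linarith)) hP fun t ht => ?_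
    have h := x.exists_stateAt_iff h1 hc hg (hbal' k₀) (hT.trans ht) i ε c 0
    simp only [abs_nonpos_iff, sub_eq_zero (b := c)] at h
    refine h.trans ?_
    have hzero : ∀ θ, d - R.r i - R.v i * θ = 0 ↔ θ = (d - R.r i) / R.v i := by
      intro θ
      rw [eq_div_iff hv.ne', sub_eq_zero, mul_comm, eq_comm]
    simp only [hσ' t ht]
    constructor
    · rintro ⟨θ, ⟨-, -, h⟩, hθ⟩
      rwa [(hzero θ).1 hθ] at h
    · intro h
      exact ⟨_, ⟨div_nonneg (by linarith) hv.le, (div_le_iff₀ hv).2 (by linarith), h⟩,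
        (hzero _).2 rfl⟩
  · intro i c hci ε
    obtain ⟨σ, hσ, hσ'⟩ := hstatus i
    obtain ⟨hd0, hd1⟩ := R.distAhead_mem (ρ := 0) (by simpa using hci) ε
    obtain ⟨a, b, ha, hab, hb, hiff⟩ := R.exists_timer_interval i ⟨hd0, by simpa using hd1⟩
    refine recursEvery_arrival hσ (ε := ε) ha hab hb hP fun t ht => ?_
    refine (x.exists_stateAt_iff h1 hc hg (hbal' k₀) (hT.trans ht) i ε c (R.r i)).trans ?_
    refine exists_congr fun θ => ?_
    rw [← hiff, hσ' t ht]
    tauto
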